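/- **Setting.** A combinatorial problem consists of a finite instance space $\mathcal I$, a finite nonempty solution space $S$ and costs $L(s;I)\in\mathbb R$. A set has description size (at most) $N$ if its elements can be identified by $N$ bits; write $N=[\mathcal I]$. For a polynomial $p$ with natural number coefficients, the problem satisfies Assumption 1 with polynomial $p$ if there are maps $\psi_S:S\to\mathbb R^{n_X}$, $\psi_{\mathcal I}:\mathcal I\to\mathbb R^{n_Z}$, a matrix $M\in\mathbb R^{n_Z\times n_X}$ and numbers $D_S,D_{\mathcal I},\alpha>0$, $C\ge 0$ such that 1. $\|\psi_S(s)\|_2\le D_S$ and $\|\psi_{\mathcal I}(I)\|_2\le D_{\mathcal I}$ for all $s\in S$, $I\in\mathcal I$; 2. $L(s;I)=\psi_{\mathcal I}(I)^\top M\,\psi_S(s)$ for all $s,I$, and $\|M\|_F\le C$; 3. $\mathrm{Var}_{s\sim U(S)}[v\cdot\psi_S(s)]\ge\alpha\|v\|_2^2$ for every $v\in\mathbb R^{n_X}$, where $U(S)$ is the uniform distribution on $S$; 4. $n_X,n_Z,D_S,D_{\mathcal I},C\le p(N)$ and $\alpha\ge 1/p(N)$; moreover, the solutions have description size $p(N)$.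 For $W\in\mathbb R^{n_Z\times n_X}$ let $\phi(s;I;W)\propto\exp(\psi_{\mathcal I}(I)^\top W\psi_S(s))$, a probability distribution on $S$ for each $I$. For $\beta,\rho\in(0,1)$ let $p_{\beta,\rho}(\cdot;I;W)=(1-\beta)\,\phi(\cdot;I;W)+\beta\,\phi(\cdot;I;\rho W)$. For a prior $\mathcal R$ over $\mathcal I$ let $$\mathcal L(W)=\mathbf E_{I\sim\mathcal R}\,\mathbf E_{s\sim p_{\beta,\rho}(\cdot;I;W)}[L(s;I)],\qquad \mathrm{opt}=\mathbf E_{I\sim\mathcal R}\big[\min_{s\in S}L(s;I)\big],$$ $$H(W)=\mathbf E_{I\sim\mathcal R}\,\mathbf E_{s\sim\phi(\cdot;I;W)}[\log\phi(s;I;W)],\qquad \mathcal L_\lambda(W)=\mathcal L(W)+\lambda\Big((1-\beta)H(W)+\tfrac{\beta}{\rho}H(\rho W)\Big).$$ **Theorem 1.** For every polynomial $p$ there is a polynomial $q$ such that for all $N$ and $\varepsilon>0$ there are $\beta,\rho\in(0,1)$, $\lambda,B>0$ with $1/\beta,\,1/\rho,\,1/\lambda,\,B\le q(N+1/\varepsilon)$,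 and for every $V\ge 0$ a step size $\eta_V>0$ and a number $T_V\ge1$ with $T_V\le q(N+1/\varepsilon+V)$, such that the following holds for every combinatorial problem whose instance space has description size $N$ and that satisfies Assumption 1 with polynomial $p$, and for every prior $\mathcal R$ over $\mathcal I$. Let $\mathcal W=\{W\in\mathbb R^{n_Z\times n_X}:\|W\|_F\le B\}$ and $\overline W=-M/\lambda$. Then the family of solution generators $\{p_{\beta,\rho}(W):W\in\mathcal W\}$ is * *complete*: $\overline W\in\mathcal W$ and $\mathcal L(\overline W)\le\mathrm{opt}+\varepsilon$; * *compressed*: it has $n_Zn_X\le q(N)$ real parameters, and for every $\delta>0$ the elements of $\mathcal W$ can be identified up to Frobenius error $\delta$ by at most $q\big(N+\log(1+1/\varepsilon)+\log(1+1/\delta)\big)$ bits, each bit string standing for an element of $\mathcal W$; * *efficiently optimizable*: $\mathcal L_\lambda$ is differentiable on $\mathbb R^{n_Z\times n_X}$. For every run $W_0,W_1,\dots$ of gradient descent on $\mathcal L_\lambda$ with projection onto $\mathcal W$, step size $\eta_0$ and any start $W_0\in\mathcal W$, and every $T\ge T_0$, some $t\in\{1,\dots,T\}$ has $\mathcal L(W_t)\le\mathcal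 L(\overline W)+\varepsilon$. For every $V\ge0$ and every run of projected stochastic gradient descent on $\mathcal L_\lambda$ with step size $\eta_V$, any (possibly random) start in $\mathcal W$, and square-integrable gradient estimates that are unbiased given the past and have variance at most $V$, and for every $T\ge T_V$, $\frac1T\sum_{t=1}^T\mathbf E[\mathcal L(W_t)]\le\mathcal L(\overline W)+\varepsilon$. -/

import Mathlib

open MeasureTheory ProbabilityTheory

universe u v w

namespace CombOpt

/-! Finite distributions. -/

/-- Expectation of `f` under the distribution `μ` on a finite type. -/
noncomputable def expect {A : Type*} [Fintype A] (μ : stdSimplex ℝ A) (f : A → ℝ) : ℝ :=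
  ∑ a, μ a * f a

/-- Variance of `f` under the distribution `μ` on a finite type. -/
noncomputable def variance {A : Type*} [Fintype A] (μ : stdSimplex ℝ A) (f : A → ℝ) : ℝ :=
  expect μ fun a => (f a - expect μ f) ^ 2

/-- The uniform distribution on a finite nonempty type. -/
noncomputable def uniform (A : Type*) [Fintype A] [Nonempty A] : stdSimplex ℝ A :=
  ⟨fun _ => (Fintype.card A : ℝ)⁻¹, fun _ => by positivity, by simp⟩

/-- The mixture `(1 - β) μ + β ν`, for `β ∈ (0, 1)`. -/
noncomputable def mix {A : Type*} [Fintype A] (β : Set.Ioo (0 : ℝ) 1) (μ ν : stdSimplex ℝ A) :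
    stdSimplex ℝ A :=
  ⟨fun a => (1 - β.1) * μ a + β.1 * ν a,
    (convex_stdSimplex ℝ A) μ.2 ν.2 (sub_nonneg.2 β.2.2.le) β.2.1.le (by ring)⟩

/-! Combinatorial problems, solution generators and their loss. -/

/-- Every element of `A` can be identified by `N` bits. -/
def HasDescriptionSize (A : Type*) (N : ℕ) : Prop :=
  ∃ enc : A → (Fin N → Bool), Function.Injective enc

/-- A solution generator sends an instance to a distribution over solutions. -/
abbrev SolutionGenerator (I S : Type*) [Fintype S] : Type _ := I → stdSimplex ℝ S

/-- Expected cost, over the prior `R`, of the solutions produced by the generator `p`. -/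
noncomputable def genLoss {I S : Type*} [Fintype I] [Fintype S] (R : stdSimplex ℝ I)
    (L : I → S → ℝ) (p : SolutionGenerator I S) : ℝ :=
  expect R fun i => expect (p i) (L i)

/-- Expected optimal cost over the prior `R`. -/
noncomputable def opt {I S : Type*} [Fintype I] (R : stdSimplex ℝ I) (L : I → S → ℝ) : ℝ :=
  expect R fun i => ⨅ s, L i s

/-! Structured feature mappings. -/

/-- Real `m × n` matrices; the Euclidean norm is the Frobenius norm. -/
abbrev Mat (m n : ℕ) : Type := EuclideanSpace ℝ (Fin m × Fin n)

/-- The bilinear form `zᵀ W x`. -/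
noncomputable def bilin {m n : ℕ} (W : Mat m n) (z : EuclideanSpace ℝ (Fin m))
    (x : EuclideanSpace ℝ (Fin n)) : ℝ :=
  ∑ a, ∑ b, z a * W (a, b) * x b

/-- Feature mappings for the problem with cost `L s I` (written `L I s` here): bounded, with
bilinear cost, and variance preserving under the uniform distribution over all solutions. -/
structure FeatureMaps {I S : Type*} [Fintype S] [Nonempty S] (L : I → S → ℝ) where
  nX : ℕ
  nZ : ℕ
  psiS : S → EuclideanSpace ℝ (Fin nX)
  psiI : I → EuclideanSpace ℝ (Fin nZ)
  M : Mat nZ nX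
  DS : ℝ
  DI : ℝ
  C : ℝ
  α : ℝ
  DS_pos : 0 < DS
  DI_pos : 0 < DI
  norm_psiS_le : ∀ s, ‖psiS s‖ ≤ DS
  norm_psiI_le : ∀ i, ‖psiI i‖ ≤ DI
  cost_eq : ∀ i s, L i s = bilin M (psiI i) (psiS s)
  norm_M_le : ‖M‖ ≤ C
  α_pos : 0 < α
  variance_ge : ∀ v : EuclideanSpace ℝ (Fin nX),
    α * ‖v‖ ^ 2 ≤ variance (uniform S) fun s => inner ℝ v (psiS s)

/-- The value at `x` of the polynomial `q` with natural number coefficients. -/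
noncomputable def polyAt (q : Polynomial ℕ) (x : ℝ) : ℝ := Polynomial.aeval x q

namespace FeatureMaps

variable {I S : Type*} [Fintype S] [Nonempty S] {L : I → S → ℝ}

/-- Dimensions and diameter bounds are at most `p(N)`, the variance bound at least `1 / p(N)`. -/
structure PolyBounded (F : FeatureMaps L) (p : Polynomial ℕ) (N : ℕ) : Prop where
  nX_le : (F.nX : ℝ) ≤ polyAt p N
  nZ_le : (F.nZ : ℝ) ≤ polyAt p N
  DS_le : F.DS ≤ polyAt p N
  DI_le : F.DI ≤ polyAt p N
  C_le : F.C ≤ polyAt p N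
  one_le : 1 ≤ F.α * polyAt p N

/-- The space of parameters: real `nZ × nX` matrices. -/
abbrev Param (F : FeatureMaps L) : Type := Mat F.nZ F.nX

/-- The score `zᵀ W x` of the solution `s` for the instance `i`, with `z = ψ_I(i)` and
`x = ψ_S(s)`. -/
noncomputable def score (F : FeatureMaps L) (W : F.Param) (i : I) (s : S) : ℝ :=
  bilin W (F.psiI i) (F.psiS s)

/-- The exponential family `φ(s; i; W) ∝ exp (zᵀ W x)`. -/
noncomputable def expFam (F : FeatureMaps L) (W : F.Param) : SolutionGenerator I S := fun i =>
  ⟨fun s => Real.exp (F.score W i s) / ∑ s', Real.exp (F.score W i s'),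
    fun s => by positivity, by
      rw [← Finset.sum_div]
      exact div_self (Finset.sum_pos (fun s _ => Real.exp_pos _) Finset.univ_nonempty).ne'⟩

/-- The fast/slow mixture `(1 - β) φ(W) + β φ(ρ W)`. -/
noncomputable def mixture (F : FeatureMaps L) (β ρ : Set.Ioo (0 : ℝ) 1) (W : F.Param) :
    SolutionGenerator I S :=
  fun i => mix β (F.expFam W i) (F.expFam (ρ.1 • W) i)

/-- The negative entropy `H(W)` of the exponential family, averaged over the prior. -/
noncomputable def negEntropy [Fintype I] (F : FeatureMaps L) (R : stdSimplex ℝ I)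
    (W : F.Param) : ℝ :=
  expect R fun i => expect (F.expFam W i) fun s => Real.log (F.expFam W i s)

/-- The entropy regularizer `(1 - β) H(W) + (β / ρ) H(ρ W)` of the mixture. -/
noncomputable def regularizer [Fintype I] (F : FeatureMaps L) (R : stdSimplex ℝ I)
    (β ρ : Set.Ioo (0 : ℝ) 1) (W : F.Param) : ℝ :=
  (1 - β.1) * F.negEntropy R W + β.1 / ρ.1 * F.negEntropy R (ρ.1 • W)

/-- The loss of the mixture with parameter `W`. -/
noncomputable def loss [Fintype I] (F : FeatureMaps L) (R : stdSimplex ℝ I)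
    (β ρ : Set.Ioo (0 : ℝ) 1) (W : F.Param) : ℝ :=
  genLoss R L (F.mixture β ρ W)

/-- The entropy-regularized loss of the mixture. -/
noncomputable def regLoss [Fintype I] (F : FeatureMaps L) (R : stdSimplex ℝ I)
    (β ρ : Set.Ioo (0 : ℝ) 1) (lam : ℝ) (W : F.Param) : ℝ :=
  F.loss R β ρ W + lam * F.regularizer R β ρ W

end FeatureMaps

/-! Projected (stochastic) gradient descent. -/

section Descent

variable {E : Type*} [NormedAddCommGroup E] [InnerProductSpace ℝ E] [CompleteSpace E]

/-- `y` is a nearest point to `x` in `𝒲`. -/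
def IsProjection (𝒲 : Set E) (x y : E) : Prop :=
  y ∈ 𝒲 ∧ ∀ z ∈ 𝒲, ‖x - y‖ ≤ ‖x - z‖

/-- The sequence `x` is a run of gradient descent on `f`, with step size `η` and projection
set `𝒲`, started anywhere in `𝒲`. -/
structure IsProjectedGD (𝒲 : Set E) (f : E → ℝ) (η : ℝ) (x : ℕ → E) : Prop where
  init : x 0 ∈ 𝒲
  step : ∀ t, IsProjection 𝒲 (x t - η • gradient f (x t)) (x (t + 1))

/-- The process `x` is a run of stochastic gradient descent on `f`, with step size `η` and
projection set `𝒲`, started anywhere in `𝒲`; the step at time `t` uses `g t`, an unbiased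
estimate of the gradient at `x t`, given the past, with variance at most `V`. -/
structure IsProjectedSGD {Ω : Type*} {m : MeasurableSpace Ω} (μ : Measure Ω)
    (ℱ : Filtration ℕ m) (𝒲 : Set E) (f : E → ℝ) (η V : ℝ) (x g : ℕ → Ω → E) : Prop where
  init : ∀ ω, x 0 ω ∈ 𝒲
  adapted : StronglyAdapted ℱ x
  step : ∀ t ω, IsProjection 𝒲 (x t ω - η • g t ω) (x (t + 1) ω)
  memLp : ∀ t, MemLp (g t) 2 μ
  unbiased : ∀ t, μ[g t | ℱ t] =ᵐ[μ] fun ω => gradient f (x t ω)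
  variance_le : ∀ t, ∫ ω, ‖g t ω - gradient f (x t ω)‖ ^ 2 ∂μ ≤ V

end Descent

/-! The three requirements on a family of solution generators. The parameters range over a set
`𝒲` in a Euclidean space `E`, and `ℓ` is the loss of the generator as a function of its
parameter. -/

section Requirements

variable {E : Type*} [NormedAddCommGroup E] [InnerProductSpace ℝ E]

/-- The parameter `wbar` belongs to the family and is optimal up to `ε`. -/
def CompleteAt (𝒲 : Set E) (ℓ : E → ℝ) (optimum ε : ℝ) (wbar : E) : Prop :=
  wbar ∈ 𝒲 ∧ ℓ wbar ≤ optimum + ε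

/-- Every element of `𝒲` can be identified up to precision `δ` by `b` bits, where every bit
string stands for an element of `𝒲`. -/
def DescribedUpTo (𝒲 : Set E) (δ : ℝ) (b : ℕ) : Prop :=
  ∃ dec : (Fin b → Bool) → E, (∀ c, dec c ∈ 𝒲) ∧ ∀ x ∈ 𝒲, ∃ c, ‖x - dec c‖ ≤ δ

/-- The number of real parameters is polynomial in `N`, and the number of bits that identify a
parameter up to precision `δ` is polynomial in `N`, `log (1/ε)` and `log (1/δ)`. -/
def Compressed (q : Polynomial ℕ) (N : ℕ) (ε : ℝ) (𝒲 : Set E) : Prop :=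
  (Module.finrank ℝ E : ℝ) ≤ polyAt q N ∧
    ∀ δ : ℝ, 0 < δ → ∃ b : ℕ, DescribedUpTo 𝒲 δ b ∧
      (b : ℝ) ≤ polyAt q (N + Real.log (1 + 1 / ε) + Real.log (1 + 1 / δ))

/-- Projected gradient descent on the differentiable objective `f` finds, after at least `T 0`
updates with step size `η 0`, a parameter with loss at most `ℓ wbar + ε`; with unbiased gradient
estimates of variance at most `V`, step size `η V` and at least `T V` updates, an iterate that is
chosen uniformly at random has expected loss at most `ℓ wbar + ε`. -/
structure OptimizableByDescent {E : Type*} [NormedAddCommGroup E] [InnerProductSpace ℝ E]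
    [CompleteSpace E] (𝒲 : Set E) (ℓ f : E → ℝ) (wbar : E) (ε : ℝ)
    (η : ℝ → ℝ) (T : ℝ → ℕ) : Prop where
  differentiable : Differentiable ℝ f
  exact_descent : ∀ x : ℕ → E, IsProjectedGD 𝒲 f (η 0) x → ∀ n : ℕ, T 0 ≤ n →
    ∃ t ∈ Finset.Icc 1 n, ℓ (x t) ≤ ℓ wbar + ε
  stochastic_descent : ∀ V : ℝ, 0 ≤ V → ∀ (Ω : Type w) (m : MeasurableSpace Ω) (μ : Measure Ω)
    [IsProbabilityMeasure μ] (ℱ : Filtration ℕ m) (x g : ℕ → Ω → E),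
    IsProjectedSGD μ ℱ 𝒲 f (η V) V x g → ∀ n : ℕ, T V ≤ n →
      (∑ t ∈ Finset.Icc 1 n, ∫ ω, ℓ (x t ω) ∂μ) / n ≤ ℓ wbar + ε

end Requirements

end CombOpt

/-! The regularized loss need not be convex, but its gradient at `W` points away from `W̄ = -M /
lam` strongly enough. By `cost_add_score`, cost plus `lam` times the score of `W` equals `lam` times
the score of `W - W̄`. Derivatives of Gibbs expectations are covariances, so pairing the gradient
with `W - W̄` gives `lam` times a weighted sum of variances of the score of `W - W̄`, under the fast
and the slow component (`inner_gradient_regLoss`).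

The fast variance may degenerate and is only known to be nonnegative. The slow component has scores
bounded by 1, so it dominates `exp (-2)` times the uniform distribution, under which the features
preserve variance. Hence the pairing controls the mean of `‖(W - W̄)ᵀ z‖ ^ 2` over instances
(`mul_expect_norm_sq_le_inner_gradient`). The excess loss is at most a constant times the mean of
`‖(W - W̄)ᵀ z‖` (`loss_le_add`). By AM-GM it is at most `ε / 2` plus a polynomial factor times the
pairing (`BoundedBy.loss_le`). This inequality replaces convexity in the usual analysis of projected
stochastic descent (`IsProjectedSGD.average_le`).

Completeness: at `W̄` the fast component is a Gibbs distribution at temperature `lam`, which loses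
at most `lam log |S|`, and the slow one is cheap because `β` is small. Compression: a grid on the
parameter ball. -/

namespace CombOpt

/-! ### Expectation, covariance and variance on finite types. -/

section FiniteDistributions

variable {A : Type*} [Fintype A]

theorem expect_add (μ : stdSimplex ℝ A) (f g : A → ℝ) :
    expect μ (fun a => f a + g a) = expect μ f + expect μ g := by
  simp [expect, mul_add, Finset.sum_add_distrib]

theorem expect_sub (μ : stdSimplex ℝ A) (f g : A → ℝ) :
    expect μ (fun a => f a - g a) = expect μ f - expect μ g := by
  simp [expect, mul_sub, Finset.sum_sub_distrib]

theorem expect_const_mul (μ : stdSimplex ℝ A) (c : ℝ) (f : A → ℝ) :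
    expect μ (fun a => c * f a) = c * expect μ f := by
  simp [expect, Finset.mul_sum, mul_left_comm]

theorem expect_const (μ : stdSimplex ℝ A) (c : ℝ) : expect μ (fun _ => c) = c := by
  simp [expect, ← Finset.sum_mul, stdSimplex.sum_eq_one]

theorem expect_mono (μ : stdSimplex ℝ A) {f g : A → ℝ} (h : ∀ a, f a ≤ g a) :
    expect μ f ≤ expect μ g :=
  Finset.sum_le_sum fun a _ => mul_le_mul_of_nonneg_left (h a) (stdSimplex.zero_le μ a)

theorem abs_expect_le (μ : stdSimplex ℝ A) {f : A → ℝ} {c : ℝ} (h : ∀ a, |f a| ≤ c) :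
    |expect μ f| ≤ c := by
  rw [abs_le]
  constructor
  · rw [← expect_const μ (-c)]
    exact expect_mono μ fun a => (abs_le.1 (h a)).1
  · rw [← expect_const μ c]
    exact expect_mono μ fun a => (abs_le.1 (h a)).2

theorem expect_mix (β : Set.Ioo (0 : ℝ) 1) (μ ν : stdSimplex ℝ A) (f : A → ℝ) :
    expect (mix β μ ν) f = (1 - β.1) * expect μ f + β.1 * expect ν f := by
  unfold expect
  rw [Finset.mul_sum, Finset.mul_sum, ← Finset.sum_add_distrib]
  refine Finset.sum_congr rfl fun a _ => ?_
  change ((1 - β.1) * μ a + β.1 * ν a) * f a = _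
  ring

/-- Covariance of `f` and `g` under the distribution `μ` on a finite type. -/
noncomputable def cov (μ : stdSimplex ℝ A) (f g : A → ℝ) : ℝ :=
  expect μ (fun a => f a * g a) - expect μ f * expect μ g

theorem cov_add_left (μ : stdSimplex ℝ A) (f g h : A → ℝ) :
    cov μ (fun a => f a + g a) h = cov μ f h + cov μ g h := by
  simp only [cov, add_mul, expect_add]
  ring

theorem cov_const_mul_left (μ : stdSimplex ℝ A) (c : ℝ) (f g : A → ℝ) :
    cov μ (fun a => c * f a) g = c * cov μ f g := by
  simp only [cov, mul_assoc, expect_const_mul]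
  ring

theorem cov_const_mul_right (μ : stdSimplex ℝ A) (c : ℝ) (f g : A → ℝ) :
    cov μ f (fun a => c * g a) = c * cov μ f g := by
  simp only [cov, mul_left_comm _ c, expect_const_mul]
  ring

/-- Bias-variance decomposition: the mean minimizes the quadratic deviation, which lets variances
under different distributions be compared. -/
theorem expect_sub_sq (μ : stdSimplex ℝ A) (f : A → ℝ) (c : ℝ) :
    expect μ (fun a => (f a - c) ^ 2) = cov μ f f + (expect μ f - c) ^ 2 := by
  have h : (fun a => (f a - c) ^ 2) = fun a => f a * f a + ((-2 * c) * f a + c ^ 2) := by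
    funext a; ring
  rw [h, expect_add, expect_add, expect_const_mul, expect_const, cov]
  ring

theorem variance_eq_cov (μ : stdSimplex ℝ A) (f : A → ℝ) : variance μ f = cov μ f f := by
  rw [variance, expect_sub_sq]; simp

theorem variance_nonneg (μ : stdSimplex ℝ A) (f : A → ℝ) : 0 ≤ variance μ f := by
  rw [variance, ← expect_const μ 0]
  exact expect_mono μ fun a => sq_nonneg _

theorem abs_cov_le (μ : stdSimplex ℝ A) {f g : A → ℝ} {a b : ℝ} (ha : 0 ≤ a)
    (hf : ∀ x, |f x| ≤ a) (hg : ∀ x, |g x| ≤ b) : |cov μ f g| ≤ 2 * (a * b) := by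
  have h1 : |expect μ (fun x => f x * g x)| ≤ a * b := abs_expect_le μ fun x => by
    rw [abs_mul]; exact mul_le_mul (hf x) (hg x) (abs_nonneg _) ha
  have h2 : |expect μ f * expect μ g| ≤ a * b := by
    rw [abs_mul]
    exact mul_le_mul (abs_expect_le μ hf) (abs_expect_le μ hg) (abs_nonneg _) ha
  rw [cov]
  exact (abs_sub _ _).trans (by linarith)

/-- If `μ ≥ c ν` pointwise, then the variance under `μ` is at least `c` times the one under
`ν`. -/
theorem mul_variance_le (μ ν : stdSimplex ℝ A) {c : ℝ} (hc : 0 ≤ c) (h : ∀ a, c * ν a ≤ μ a)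
    (f : A → ℝ) : c * variance ν f ≤ variance μ f := by
  have h1 : variance ν f ≤ expect ν (fun a => (f a - expect μ f) ^ 2) := by
    rw [expect_sub_sq, variance_eq_cov]
    exact le_add_of_nonneg_right (sq_nonneg _)
  refine (mul_le_mul_of_nonneg_left h1 hc).trans ?_
  rw [variance, expect, expect, Finset.mul_sum]
  refine Finset.sum_le_sum fun a _ => ?_
  rw [← mul_assoc]
  exact mul_le_mul_of_nonneg_right (h a) (sq_nonneg _)

end FiniteDistributions

/-! ### Gibbs distributions: derivatives, near-optimality, comparison with the uniform distribution.
-/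

section Gibbs

variable {S : Type*} [Fintype S]

/-- The partition function of the score `h`. -/
noncomputable def partition (h : S → ℝ) : ℝ := ∑ s, Real.exp (h s)

theorem hasDerivAt_partition (h k : S → ℝ) (t : ℝ) :
    HasDerivAt (fun t : ℝ => partition fun s => h s + t * k s)
      (∑ s, Real.exp (h s + t * k s) * k s) t := by
  unfold partition
  refine HasDerivAt.fun_sum fun s _ => ?_
  have := (((hasDerivAt_id t).mul_const (k s)).const_add (h s)).exp
  simpa using this

variable [Nonempty S]

theorem partition_pos (h : S → ℝ) : 0 < partition h :=
  Finset.sum_pos (fun _ _ => Real.exp_pos _) Finset.univ_nonempty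

/-- The Gibbs distribution proportional to `exp h`. -/
noncomputable def gibbs (h : S → ℝ) : stdSimplex ℝ S :=
  ⟨fun s => Real.exp (h s) / partition h,
    fun _ => div_nonneg (Real.exp_pos _).le (partition_pos h).le, by
      rw [← Finset.sum_div]
      exact div_self (partition_pos h).ne'⟩

theorem gibbs_apply (h : S → ℝ) (s : S) : gibbs h s = Real.exp (h s) / partition h := rfl

theorem expect_gibbs (h f : S → ℝ) :
    expect (gibbs h) f = (∑ s, Real.exp (h s) * f s) / partition h := by
  rw [expect, Finset.sum_div]
  refine Finset.sum_congr rfl fun s _ => ?_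
  rw [gibbs_apply]; ring

theorem log_gibbs (h : S → ℝ) (s : S) : Real.log (gibbs h s) = h s - Real.log (partition h) := by
  rw [gibbs_apply, Real.log_div (Real.exp_pos _).ne' (partition_pos h).ne', Real.log_exp]

theorem expect_log_gibbs (h : S → ℝ) :
    expect (gibbs h) (fun s => Real.log (gibbs h s)) =
      expect (gibbs h) h - Real.log (partition h) := by
  simp only [log_gibbs]
  rw [expect_sub, expect_const]

/-- Along the line of scores `h + t k`, each probability has logarithmic derivative `k` minus its
mean; averaging `f` against this gives a covariance. -/
theorem hasDerivAt_expect_gibbs (h k f : S → ℝ) (t : ℝ) :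
    HasDerivAt (fun t : ℝ => expect (gibbs fun s => h s + t * k s) f)
      (cov (gibbs fun s => h s + t * k s) f k) t := by
  have h1 : HasDerivAt (fun t : ℝ => ∑ s, Real.exp (h s + t * k s) * f s)
      (∑ s, Real.exp (h s + t * k s) * (f s * k s)) t := by
    refine HasDerivAt.fun_sum fun s _ => ?_
    have := ((((hasDerivAt_id t).mul_const (k s)).const_add (h s)).exp).mul_const (f s)
    simpa [mul_assoc, mul_comm (f s)] using this
  have h2 := h1.div (hasDerivAt_partition h k t) (partition_pos _).ne'
  simp only [expect_gibbs, cov]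
  convert! h2 using 1
  have := (partition_pos fun s => h s + t * k s).ne'
  field_simp

theorem hasDerivAt_log_partition (h k : S → ℝ) (t : ℝ) :
    HasDerivAt (fun t : ℝ => Real.log (partition fun s => h s + t * k s))
      (expect (gibbs fun s => h s + t * k s) k) t := by
  rw [expect_gibbs]
  exact (hasDerivAt_partition h k t).log (partition_pos _).ne'

theorem hasDerivAt_expect_log_gibbs (h k : S → ℝ) (t : ℝ) :
    HasDerivAt (fun t : ℝ => expect (gibbs fun s => h s + t * k s)
        fun s => Real.log (gibbs (fun s => h s + t * k s) s))
      (cov (gibbs fun s => h s + t * k s) (fun s => h s + t * k s) k) t := by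
  simp only [expect_log_gibbs, expect_add, expect_const_mul]
  have h1 := (((hasDerivAt_expect_gibbs h k h t).add
    ((hasDerivAt_id t).mul (hasDerivAt_expect_gibbs h k k t)))).sub
    (hasDerivAt_log_partition h k t)
  convert! h1 using 1
  -- The mean of `k` from the product rule cancels the derivative of the log-partition function.
  rw [cov_add_left, cov_const_mul_left, one_mul, id]
  ring

/-- The Gibbs distribution at inverse temperature `1 / lam` is optimal up to `lam log |S|`. -/
theorem expect_gibbs_le (ℓ : S → ℝ) {lam : ℝ} (hlam : 0 < lam) (s₀ : S) :
    expect (gibbs fun s => -(1 / lam) * ℓ s) ℓ ≤ ℓ s₀ + lam * Real.log (Fintype.card S) := by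
  set h : S → ℝ := fun s => -(1 / lam) * ℓ s with hh
  have hcard : (0 : ℝ) < Fintype.card S := by exact_mod_cast Fintype.card_pos
  have h1 : expect (gibbs h) h = -(1 / lam) * expect (gibbs h) ℓ := expect_const_mul _ _ _
  have h2 : h s₀ ≤ Real.log (partition h) := by
    rw [← Real.log_exp (h s₀)]
    exact Real.log_le_log (Real.exp_pos _)
      (Finset.single_le_sum (f := fun s => Real.exp (h s)) (fun s _ => (Real.exp_pos _).le)
        (Finset.mem_univ s₀))
  -- Entropy is at most `log |S|`: use `1 - 1 / y ≤ log y` at `y = |S|` times the probability. The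
  -- left sides of `h4` sum to zero.
  have h3 : -Real.log (Fintype.card S) ≤ expect (gibbs h) (fun s => Real.log (gibbs h s)) := by
    have h4 : ∀ s, gibbs h s - (Fintype.card S : ℝ)⁻¹ ≤
        gibbs h s * (Real.log (gibbs h s) + Real.log (Fintype.card S)) := fun s => by
      have hp : 0 < gibbs h s := div_pos (Real.exp_pos _) (partition_pos h)
      have := Real.one_sub_inv_le_log_of_pos (mul_pos hp hcard)
      rw [← Real.log_mul hp.ne' hcard.ne']
      calc gibbs h s - (Fintype.card S : ℝ)⁻¹
          = gibbs h s * (1 - (gibbs h s * (Fintype.card S : ℝ))⁻¹) := by field_simp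
        _ ≤ _ := mul_le_mul_of_nonneg_left this hp.le
    have h5 := Finset.sum_le_sum fun s (_ : s ∈ Finset.univ) => h4 s
    rw [Finset.sum_sub_distrib, stdSimplex.sum_eq_one] at h5
    change _ ≤ expect (gibbs h) (fun s => Real.log (gibbs h s) + Real.log (Fintype.card S)) at h5
    rw [expect_add, expect_const] at h5
    simp at h5
    linarith
  rw [expect_log_gibbs, h1] at h3
  have h6 : h s₀ = -(1 / lam) * ℓ s₀ := rfl
  rw [h6] at h2
  have h7 : (1 / lam) * expect (gibbs h) ℓ ≤ 1 / lam * ℓ s₀ + Real.log (Fintype.card S) := by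
    linarith
  have h8 := mul_le_mul_of_nonneg_left h7 hlam.le
  have h9 : lam * (1 / lam) = 1 := by field_simp
  calc expect (gibbs h) ℓ = lam * (1 / lam * expect (gibbs h) ℓ) := by
        rw [← mul_assoc, h9, one_mul]
    _ ≤ _ := h8
    _ = _ := by rw [mul_add, ← mul_assoc, h9, one_mul]

/-- The expectation of `f` under Gibbs distributions is Lipschitz in the score. -/
theorem abs_expect_gibbs_sub_le (h h' f : S → ℝ) {a b : ℝ} (ha : 0 ≤ a) (hf : ∀ s, |f s| ≤ a)
    (hh : ∀ s, |h' s - h s| ≤ b) :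
    |expect (gibbs h') f - expect (gibbs h) f| ≤ 2 * (a * b) := by
  -- Mean value inequality on the segment of scores from `h` to `h'`, where the derivative is a
  -- covariance of bounded functions.
  have key := norm_image_sub_le_of_norm_deriv_le_segment_01'
    (f := fun t : ℝ => expect (gibbs fun s => h s + t * (h' s - h s)) f)
    (fun t _ => (hasDerivAt_expect_gibbs h (fun s => h' s - h s) f t).hasDerivWithinAt)
    (C := 2 * (a * b)) (fun t _ => abs_cov_le _ ha hf hh)
  simpa using key

/-- A Gibbs distribution with scores bounded by `b` is at least `exp (-2 b)` times the uniform
distribution. -/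
theorem mul_uniform_le_gibbs {h : S → ℝ} {b : ℝ} (hb : ∀ s, |h s| ≤ b) (s : S) :
    Real.exp (-(2 * b)) * uniform S s ≤ gibbs h s := by
  have hcard : (0 : ℝ) < Fintype.card S := by exact_mod_cast Fintype.card_pos
  have h1 : partition h ≤ Fintype.card S * Real.exp b := by
    have := Finset.sum_le_card_nsmul Finset.univ (fun s => Real.exp (h s)) (Real.exp b)
      (fun s _ => Real.exp_le_exp.2 (abs_le.1 (hb s)).2)
    simpa [partition] using this
  have h2 : Real.exp (-b) ≤ Real.exp (h s) := Real.exp_le_exp.2 (abs_le.1 (hb s)).1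
  change Real.exp (-(2 * b)) * (Fintype.card S : ℝ)⁻¹ ≤ _
  rw [gibbs_apply, le_div_iff₀ (partition_pos h)]
  calc Real.exp (-(2 * b)) * (Fintype.card S : ℝ)⁻¹ * partition h
      ≤ Real.exp (-(2 * b)) * (Fintype.card S : ℝ)⁻¹ * (Fintype.card S * Real.exp b) := by
        gcongr
    _ = Real.exp (-(2 * b) + b) := by rw [Real.exp_add]; field_simp
    _ = Real.exp (-b) := by ring_nf
    _ ≤ _ := h2

end Gibbs

/-! ### Projected stochastic gradient descent under a correlation condition. -/

section Descent

variable {E : Type*} [NormedAddCommGroup E] [InnerProductSpace ℝ E]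

/-- Projecting onto a convex set does not increase the distance to its points. -/
theorem IsProjection.norm_sub_le {𝒲 : Set E} (h𝒲 : Convex ℝ 𝒲) {x y w : E}
    (h : IsProjection 𝒲 x y) (hw : w ∈ 𝒲) : ‖y - w‖ ≤ ‖x - w‖ := by
  -- In this form the nearest point obeys the variational inequality `⟨x - y, w - y⟩ ≤ 0`.
  have hmin : ‖x - y‖ = ⨅ z : 𝒲, ‖x - z‖ := by
    have : Nonempty 𝒲 := ⟨⟨w, hw⟩⟩
    refine le_antisymm (le_ciInf fun z => h.2 z z.2) ?_
    exact ciInf_le ⟨0, by rintro _ ⟨z, rfl⟩; exact norm_nonneg _⟩ (⟨y, h.1⟩ : 𝒲)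
  have h1 := (norm_eq_iInf_iff_real_inner_le_zero h𝒲 h.1).1 hmin w hw
  have h2 : ‖x - w‖ ^ 2 = ‖x - y‖ ^ 2 + 2 * inner ℝ (x - y) (y - w) + ‖y - w‖ ^ 2 := by
    rw [← norm_add_sq_real]; congr 2; abel
  have h3 : inner ℝ (x - y) (y - w) = - inner ℝ (x - y) (w - y) := by
    rw [← inner_neg_right]; congr 1; abel
  refine le_of_sq_le_sq ?_ (norm_nonneg _)
  nlinarith [sq_nonneg ‖x - y‖]

/-- One step of projected descent. -/
theorem IsProjection.norm_sq_sub_le {𝒲 : Set E} (h𝒲 : Convex ℝ 𝒲) {x y g w : E} {η : ℝ}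
    (h : IsProjection 𝒲 (x - η • g) y) (hw : w ∈ 𝒲) :
    ‖y - w‖ ^ 2 ≤ ‖x - w‖ ^ 2 - 2 * η * inner ℝ (x - w) g + η ^ 2 * ‖g‖ ^ 2 := by
  have h1 := pow_le_pow_left₀ (norm_nonneg _) (h.norm_sub_le h𝒲 hw) 2
  have h2 : x - η • g - w = (x - w) - η • g := by abel
  rw [h2, norm_sub_sq_real (x - w), inner_smul_right, norm_smul, mul_pow, Real.norm_eq_abs, sq_abs] at h1
  linarith

variable [CompleteSpace E]

theorem integrable_comp_of_continuous {Ω : Type*} {m : MeasurableSpace Ω} {μ : Measure Ω}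
    [IsFiniteMeasure μ] {F G : Type*} [NormedAddCommGroup F] [ProperSpace F]
    [NormedAddCommGroup G] {x : Ω → F} (hx : AEStronglyMeasurable x μ) {B : ℝ}
    (hB : ∀ ω, x ω ∈ Metric.closedBall 0 B) {ℓ : F → G} (hℓ : Continuous ℓ) :
    Integrable (fun ω => ℓ (x ω)) μ := by
  obtain ⟨C, hC⟩ := (isCompact_closedBall (0 : F) B).exists_bound_of_continuousOn hℓ.continuousOn
  exact Integrable.of_bound (hℓ.comp_aestronglyMeasurable hx) C
    (Filter.Eventually.of_forall fun ω => hC _ (hB ω))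

/-- The correlation of a stochastic gradient step with the direction to `w`. -/
theorem IsProjectedSGD.inner_le [ProperSpace E] {Ω : Type*} {m : MeasurableSpace Ω}
    {μ : Measure Ω} [IsProbabilityMeasure μ] {ℱ : Filtration ℕ m} {B : ℝ} {f : E → ℝ} {η V : ℝ}
    {x g : ℕ → Ω → E} (h : IsProjectedSGD μ ℱ (Metric.closedBall 0 B) f η V x g) {G : ℝ}
    (hG : ∀ y ∈ Metric.closedBall (0 : E) B, ‖gradient f y‖ ≤ G) {w : E}
    (hw : w ∈ Metric.closedBall (0 : E) B) (t : ℕ) :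
    Integrable (fun ω => inner ℝ (x t ω - w) (gradient f (x t ω))) μ ∧
    2 * η * ∫ ω, inner ℝ (x t ω - w) (gradient f (x t ω)) ∂μ ≤
      (∫ ω, ‖x t ω - w‖ ^ 2 ∂μ) - (∫ ω, ‖x (t + 1) ω - w‖ ^ 2 ∂μ) + η ^ 2 * (2 * G ^ 2 + 2 * V) := by
  have hmem : ∀ t ω, x t ω ∈ Metric.closedBall (0 : E) B := fun t ω => by
    cases t with
    | zero => exact h.init ω
    | succ t => exact (h.step t ω).1
  have hxm : ∀ t, StronglyMeasurable[ℱ t] (x t) := h.adapted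
  have hx : ∀ t, AEStronglyMeasurable (x t) μ := fun t =>
    ((hxm t).mono (ℱ.le t)).aestronglyMeasurable
  have hg : Integrable (g t) μ := (h.memLp t).integrable one_le_two
  have hg2 : Integrable (fun ω => ‖g t ω‖ ^ 2) μ := (h.memLp t).integrable_norm_pow two_ne_zero
  -- No regularity of the gradient is assumed; measurability comes from its agreeing almost
  -- everywhere with a conditional expectation.
  have hgrad : AEStronglyMeasurable (fun ω => gradient f (x t ω)) μ :=
    (stronglyMeasurable_condExp.mono (ℱ.le t)).aestronglyMeasurable.congr (h.unbiased t)
  have hgradL : MemLp (fun ω => gradient f (x t ω)) 2 μ :=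
    MemLp.of_bound hgrad G (Filter.Eventually.of_forall fun ω => hG _ (hmem t ω))
  have hd : Integrable (fun ω => ‖g t ω - gradient f (x t ω)‖ ^ 2) μ :=
    ((h.memLp t).sub hgradL).integrable_norm_pow two_ne_zero
  have hbd : ∀ ω, ‖x t ω - w‖ ≤ 2 * B := fun ω => by
    have h1 := hmem t ω
    rw [mem_closedBall_zero_iff] at h1 hw
    exact (norm_sub_le _ _).trans (by linarith)
  have hxw : AEStronglyMeasurable (fun ω => x t ω - w) μ := 
    (hx t).sub aestronglyMeasurable_const
  have hi1 : Integrable (fun ω => inner ℝ (x t ω - w) (g t ω)) μ :=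
    (innerSL ℝ (E := E)).integrable_of_bilin_of_bdd_left (2 * B) hxw
      (Filter.Eventually.of_forall hbd) hg
  have hi2 : Integrable (fun ω => inner ℝ (x t ω - w) (gradient f (x t ω))) μ :=
    (innerSL ℝ (E := E)).integrable_of_bilin_of_bdd_left (2 * B) hxw
      (Filter.Eventually.of_forall hbd) (hgradL.integrable one_le_two)
  -- Given the past, `x t - w` is known and pulls out of the conditional expectation, so `g t` may
  -- be replaced by its conditional mean.
  have hpull : ∫ ω, inner ℝ (x t ω - w) (g t ω) ∂μ =
      ∫ ω, inner ℝ (x t ω - w) (gradient f (x t ω)) ∂μ := by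
    have h1 := condExp_stronglyMeasurable_bilin_of_bound (innerSL ℝ (E := E)) (ℱ.le t)
      ((hxm t).sub stronglyMeasurable_const) hg (2 * B) (Filter.Eventually.of_forall hbd)
      (μ := μ) (f := fun ω => x t ω - w)
    rw [← integral_condExp (ℱ.le t)]
    refine integral_congr_ae (h1.trans ?_)
    filter_upwards [h.unbiased t] with ω hω
    rw [hω]; rfl
  have hn : ∀ t, Integrable (fun ω => ‖x t ω - w‖ ^ 2) μ := fun t =>
    integrable_comp_of_continuous (hx t) (hmem t) (ℓ := fun y => ‖y - w‖ ^ 2) (by fun_prop)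
  have hsq : ∫ ω, ‖g t ω‖ ^ 2 ∂μ ≤ 2 * G ^ 2 + 2 * V := by
    calc ∫ ω, ‖g t ω‖ ^ 2 ∂μ
        ≤ ∫ ω, (2 * G ^ 2 + 2 * ‖g t ω - gradient f (x t ω)‖ ^ 2) ∂μ := by
          refine integral_mono hg2 ((integrable_const _).add (hd.const_mul 2)) fun ω => ?_
          have h1 : ‖g t ω‖ ≤ G + ‖g t ω - gradient f (x t ω)‖ := by
            have := norm_add_le (gradient f (x t ω)) (g t ω - gradient f (x t ω))
            rw [add_sub_cancel] at this
            linarith [hG _ (hmem t ω)]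
          have h2 := pow_le_pow_left₀ (norm_nonneg _) h1 2
          change ‖g t ω‖ ^ 2 ≤ 2 * G ^ 2 + 2 * ‖g t ω - gradient f (x t ω)‖ ^ 2
          nlinarith [sq_nonneg (G - ‖g t ω - gradient f (x t ω)‖)]
      _ = 2 * G ^ 2 + 2 * ∫ ω, ‖g t ω - gradient f (x t ω)‖ ^ 2 ∂μ := by
          rw [integral_add (integrable_const _) (hd.const_mul 2)]
          simp [integral_const_mul]
      _ ≤ _ := by linarith [h.variance_le t]
  refine ⟨hi2, ?_⟩
  have hi3 : Integrable (fun ω => ‖x t ω - w‖ ^ 2 - 2 * η * inner ℝ (x t ω - w) (g t ω)) μ :=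
    (hn t).sub (hi1.const_mul _)
  have hstep : ∫ ω, ‖x (t + 1) ω - w‖ ^ 2 ∂μ ≤
      ∫ ω, (‖x t ω - w‖ ^ 2 - 2 * η * inner ℝ (x t ω - w) (g t ω) + η ^ 2 * ‖g t ω‖ ^ 2) ∂μ := by
    refine integral_mono (hn (t + 1)) (hi3.add (hg2.const_mul _))
      fun ω => ?_
    exact (h.step t ω).norm_sq_sub_le (convex_closedBall 0 B) hw
  rw [integral_add hi3 (hg2.const_mul _), integral_sub (hn t) (hi1.const_mul _), integral_const_mul, integral_const_mul, hpull] at hstep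
  nlinarith [mul_le_mul_of_nonneg_left hsq (sq_nonneg η)]

/-- If the excess loss is at most `e + c ⟨W - wbar, ∇f(W)⟩`, then projected stochastic gradient
descent on `f` brings the average excess loss down to `e`, at the usual rate. -/
theorem IsProjectedSGD.average_le [ProperSpace E] {Ω : Type*} {m : MeasurableSpace Ω}
    {μ : Measure Ω} [IsProbabilityMeasure μ] {ℱ : Filtration ℕ m} {B : ℝ} {f : E → ℝ} {η V : ℝ}
    {x g : ℕ → Ω → E} (h : IsProjectedSGD μ ℱ (Metric.closedBall 0 B) f η V x g) (hη : 0 < η)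
    {G : ℝ} (hG : ∀ y ∈ Metric.closedBall (0 : E) B, ‖gradient f y‖ ≤ G) {w : E}
    (hw : w ∈ Metric.closedBall (0 : E) B) {ℓ : E → ℝ} (hℓ : Continuous ℓ) {c e : ℝ} (hc : 0 ≤ c)
    (hcorr : ∀ y ∈ Metric.closedBall (0 : E) B, ℓ y ≤ ℓ w + e + c * inner ℝ (y - w) (gradient f y))
    {n : ℕ} (hn : 0 < n) :
    (∑ t ∈ Finset.Icc 1 n, ∫ ω, ℓ (x t ω) ∂μ) / n ≤
      ℓ w + e + c * (2 * B ^ 2 / (η * n) + η * (G ^ 2 + V)) := by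
  have hmem : ∀ t ω, x t ω ∈ Metric.closedBall (0 : E) B := fun t ω => by
    cases t with
    | zero => exact h.init ω
    | succ t => exact (h.step t ω).1
  have hx : ∀ t, AEStronglyMeasurable (x t) μ := fun t =>
    ((h.adapted t).mono (ℱ.le t)).aestronglyMeasurable
  set d : ℕ → ℝ := fun t => ∫ ω, ‖x t ω - w‖ ^ 2 ∂μ with hd
  have hd0 : ∀ t, 0 ≤ d t := fun t => integral_nonneg fun ω => sq_nonneg _
  -- The averages start at time 1; both points lie in the ball, so their distance is at most `2 *
  -- B`.
  have hd1 : d 1 ≤ 4 * B ^ 2 := by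
    have h1 : d 1 ≤ ∫ _, 4 * B ^ 2 ∂μ := by
      refine integral_mono (integrable_comp_of_continuous (hx 1) (hmem 1)
        (ℓ := fun y => ‖y - w‖ ^ 2) (by fun_prop)) (integrable_const _) fun ω => ?_
      have h1 := hmem 1 ω
      rw [mem_closedBall_zero_iff] at h1 hw
      have h2 : ‖x 1 ω - w‖ ≤ 2 * B := (norm_sub_le _ _).trans (by linarith)
      have h3 := pow_le_pow_left₀ (norm_nonneg _) h2 2
      change ‖x 1 ω - w‖ ^ 2 ≤ 4 * B ^ 2
      linarith
    simpa using h1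
  set a : ℕ → ℝ := fun t => ∫ ω, inner ℝ (x t ω - w) (gradient f (x t ω)) ∂μ with ha
  have hstep : ∀ t, 2 * η * a t ≤ d t - d (t + 1) + η ^ 2 * (2 * G ^ 2 + 2 * V) := fun t =>
    (h.inner_le hG hw t).2
  have hloss : ∀ t, ∫ ω, ℓ (x t ω) ∂μ ≤ ℓ w + e + c * a t := fun t => by
    have hi := (h.inner_le hG hw t).1
    have h1 : ∫ ω, ℓ (x t ω) ∂μ ≤
        ∫ ω, (ℓ w + e + c * inner ℝ (x t ω - w) (gradient f (x t ω))) ∂μ :=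
      integral_mono (integrable_comp_of_continuous (hx t) (hmem t) hℓ)
        ((integrable_const _).add (hi.const_mul c)) fun ω => hcorr _ (hmem t ω)
    rw [integral_add (integrable_const _) (hi.const_mul c), integral_const_mul,
      integral_const, probReal_univ, one_smul] at h1
    exact h1
  -- The squared distances to `w` telescope.
  have hsum : ∀ n : ℕ, 2 * η * ∑ t ∈ Finset.Icc 1 n, a t ≤
      d 1 - d (n + 1) + n * (η ^ 2 * (2 * G ^ 2 + 2 * V)) := fun n => by
    induction n with
    | zero => simp
    | succ n ih =>
      rw [Finset.sum_Icc_succ_top (by omega), mul_add]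
      push_cast
      linarith [hstep (n + 1)]
  have hn' : (0 : ℝ) < n := by exact_mod_cast hn
  have hS : ∑ t ∈ Finset.Icc 1 n, a t ≤ n * (2 * B ^ 2 / (η * n) + η * (G ^ 2 + V)) := by
    have h1 : 2 * η * ∑ t ∈ Finset.Icc 1 n, a t ≤
        2 * η * (n * (2 * B ^ 2 / (η * n) + η * (G ^ 2 + V))) := by
      calc _ ≤ 4 * B ^ 2 + n * (η ^ 2 * (2 * G ^ 2 + 2 * V)) := by
            linarith [hsum n, hd0 (n + 1)]
        _ = _ := by field_simp; ring
    exact le_of_mul_le_mul_left h1 (by positivity)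
  rw [div_le_iff₀ hn']
  calc _ ≤ ∑ t ∈ Finset.Icc 1 n, (ℓ w + e + c * a t) := Finset.sum_le_sum fun t _ => hloss t
    _ = n * (ℓ w + e) + c * ∑ t ∈ Finset.Icc 1 n, a t := by
      rw [Finset.sum_add_distrib, ← Finset.mul_sum]; simp [mul_add]
    _ ≤ n * (ℓ w + e) + c * (n * (2 * B ^ 2 / (η * n) + η * (G ^ 2 + V))) := by gcongr
    _ = _ := by ring

/-- Gradient descent is stochastic gradient descent on a one-point space. -/
theorem IsProjectedGD.isProjectedSGD {𝒲 : Set E} {f : E → ℝ} {η : ℝ} {x : ℕ → E}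
    (h : IsProjectedGD 𝒲 f η x) :
    IsProjectedSGD (Measure.dirac PUnit.unit) (⊥ : Filtration ℕ (⊤ : MeasurableSpace PUnit))
      𝒲 f η 0 (fun t _ => x t) (fun t _ => gradient f (x t)) where
  init _ := h.init
  adapted _ := stronglyMeasurable_const
  step t _ := h.step t
  memLp _ := memLp_const _
  unbiased t := by
    rw [condExp_of_stronglyMeasurable (Filtration.le _ t) stronglyMeasurable_const
      (integrable_const _)]
  variance_le t := by simp

/-- Step size and number of steps that make projected descent `ε`-optimal. -/
theorem optimizableByDescent_closedBall [ProperSpace E] {B : ℝ} {f ℓ : E → ℝ} {w : E} {c ε G : ℝ}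
    (hf : Differentiable ℝ f) (hℓ : Continuous ℓ) (hw : w ∈ Metric.closedBall (0 : E) B)
    (hc : 0 < c) (hε : 0 < ε) (hG0 : 0 < G)
    (hG : ∀ y ∈ Metric.closedBall (0 : E) B, ‖gradient f y‖ ≤ G)
    (hcorr : ∀ y ∈ Metric.closedBall (0 : E) B,
      ℓ y ≤ ℓ w + ε / 2 + c * inner ℝ (y - w) (gradient f y)) :
    OptimizableByDescent.{w} (Metric.closedBall (0 : E) B) ℓ f w ε
      (fun V => ε / (4 * c * (G ^ 2 + V)))
      (fun V => ⌈32 * c ^ 2 * B ^ 2 * (G ^ 2 + V) / ε ^ 2⌉₊ + 1) := by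
  have main : ∀ V : ℝ, 0 ≤ V → ∀ (Ω : Type w) (m : MeasurableSpace Ω) (μ : Measure Ω)
      [IsProbabilityMeasure μ] (ℱ : Filtration ℕ m) (x g : ℕ → Ω → E),
      IsProjectedSGD μ ℱ (Metric.closedBall (0 : E) B) f (ε / (4 * c * (G ^ 2 + V))) V x g →
      ∀ n : ℕ, ⌈32 * c ^ 2 * B ^ 2 * (G ^ 2 + V) / ε ^ 2⌉₊ + 1 ≤ n →
      (∑ t ∈ Finset.Icc 1 n, ∫ ω, ℓ (x t ω) ∂μ) / n ≤ ℓ w + ε := by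
    intro V hV Ω m μ _ ℱ x g h n hn
    have hD : 0 < G ^ 2 + V := by positivity
    have hn0 : (0 : ℝ) < n := by exact_mod_cast (by omega : 0 < n)
    have hn1 : 32 * c ^ 2 * B ^ 2 * (G ^ 2 + V) / ε ^ 2 ≤ n :=
      (Nat.le_ceil _).trans (by exact_mod_cast (by omega))
    refine (h.average_le (by positivity) hG hw hℓ hc.le hcorr (by omega)).trans ?_
    -- Error budget: `ε / 2` from `hcorr`, `ε / 4` from gradient noise through the step size, `ε /
    -- 4` from the initial distance through the number of steps.
    have h1 : c * (ε / (4 * c * (G ^ 2 + V)) * (G ^ 2 + V)) = ε / 4 := by field_simp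
    have h2 : c * (2 * B ^ 2 / (ε / (4 * c * (G ^ 2 + V)) * n)) ≤ ε / 4 := by
      rw [div_le_iff₀ (by positivity)] at hn1
      have h3 : c * (2 * B ^ 2 / (ε / (4 * c * (G ^ 2 + V)) * n)) =
          8 * c ^ 2 * B ^ 2 * (G ^ 2 + V) / (ε * n) := by field_simp; ring
      rw [h3, div_le_iff₀ (by positivity)]
      nlinarith
    rw [mul_add, h1]
    linarith
  refine ⟨hf, fun x hx n hn => ?_, main⟩
  have h1 := main 0 le_rfl PUnit ⊤ (Measure.dirac PUnit.unit) ⊥ _ _ hx.isProjectedSGD n hn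
  simp only [integral_const, probReal_univ, one_smul] at h1
  -- If every iterate exceeded the target, so would their average.
  by_contra! hcon
  have hn0 : (0 : ℝ) < n := by exact_mod_cast (by omega : 0 < n)
  have h2 : ∑ t ∈ Finset.Icc 1 n, (ℓ w + ε) < ∑ t ∈ Finset.Icc 1 n, ℓ (x t) :=
    Finset.sum_lt_sum_of_nonempty ⟨1, by simp; omega⟩ hcon
  rw [div_le_iff₀ hn0] at h1
  simp at h2
  linarith

end Descent

/-! ### The bilinear score and the vector `Wᵀ z`. -/

section Bilinear

variable {m n : ℕ}

/-- The vector `Wᵀ z`. -/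
noncomputable def contract (W : Mat m n) (z : EuclideanSpace ℝ (Fin m)) :
    EuclideanSpace ℝ (Fin n) :=
  WithLp.toLp 2 fun b => ∑ a, z a * W (a, b)

theorem bilin_eq_inner (W : Mat m n) (z : EuclideanSpace ℝ (Fin m))
    (x : EuclideanSpace ℝ (Fin n)) : bilin W z x = inner ℝ (contract W z) x := by
  simp only [bilin, PiLp.inner_apply, contract, RCLike.inner_apply, conj_trivial,
    Finset.mul_sum]
  rw [Finset.sum_comm]
  exact Finset.sum_congr rfl fun b _ => Finset.sum_congr rfl fun a _ => by ring

/-- Cauchy-Schwarz in each column, summed over columns. -/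
theorem norm_contract_le (W : Mat m n) (z : EuclideanSpace ℝ (Fin m)) :
    ‖contract W z‖ ≤ ‖W‖ * ‖z‖ := by
  refine le_of_sq_le_sq ?_ (by positivity)
  rw [mul_pow, EuclideanSpace.real_norm_sq_eq, EuclideanSpace.real_norm_sq_eq,
    EuclideanSpace.real_norm_sq_eq, Fintype.sum_prod_type_right, Finset.sum_mul]
  refine Finset.sum_le_sum fun b _ => ?_
  rw [mul_comm]
  exact Finset.sum_mul_sq_le_sq_mul_sq Finset.univ (fun a => z a) fun a => W (a, b)

theorem bilin_add (W G : Mat m n) (z : EuclideanSpace ℝ (Fin m)) (x : EuclideanSpace ℝ (Fin n)) :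
    bilin (W + G) z x = bilin W z x + bilin G z x := by
  simp [bilin, mul_add, add_mul, Finset.sum_add_distrib]

theorem bilin_smul (c : ℝ) (W : Mat m n) (z : EuclideanSpace ℝ (Fin m))
    (x : EuclideanSpace ℝ (Fin n)) : bilin (c • W) z x = c * bilin W z x := by
  simp only [bilin, Finset.mul_sum, PiLp.smul_apply, smul_eq_mul]
  exact Finset.sum_congr rfl fun b _ => Finset.sum_congr rfl fun a _ => by ring

theorem differentiable_bilin (z : EuclideanSpace ℝ (Fin m)) (x : EuclideanSpace ℝ (Fin n)) :
    Differentiable ℝ fun W : Mat m n => bilin W z x := by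
  unfold bilin
  fun_prop

end Bilinear

/-! ### Differentiability of Gibbs expectations and of averages over the prior. -/

section GibbsDifferentiable

variable {S E : Type*} [Fintype S] [NormedAddCommGroup E] [NormedSpace ℝ E]

theorem differentiable_partition {h : E → S → ℝ} (hh : ∀ s, Differentiable ℝ fun W => h W s) :
    Differentiable ℝ fun W => partition (h W) := by
  unfold partition
  fun_prop

variable [Nonempty S]

theorem differentiable_expect_gibbs {h f : E → S → ℝ} (hh : ∀ s, Differentiable ℝ fun W => h W s)
    (hf : ∀ s, Differentiable ℝ fun W => f W s) :
    Differentiable ℝ fun W => expect (gibbs (h W)) (f W) := by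
  simp only [expect_gibbs, div_eq_mul_inv]
  have h1 : Differentiable ℝ fun W => ∑ s, Real.exp (h W s) * f W s := by fun_prop
  exact h1.mul ((differentiable_partition hh).inv fun W => (partition_pos (h W)).ne')

theorem differentiable_expect_log_gibbs {h : E → S → ℝ}
    (hh : ∀ s, Differentiable ℝ fun W => h W s) :
    Differentiable ℝ fun W => expect (gibbs (h W)) fun s => Real.log (gibbs (h W) s) := by
  simp only [expect_log_gibbs]
  exact (differentiable_expect_gibbs hh hh).sub
    ((differentiable_partition hh).log fun W => (partition_pos _).ne')

end GibbsDifferentiable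

section Expect

variable {A E : Type*} [Fintype A] [NormedAddCommGroup E] [NormedSpace ℝ E]

theorem differentiable_expect (R : stdSimplex ℝ A) {f : E → A → ℝ}
    (hf : ∀ a, Differentiable ℝ fun W => f W a) : Differentiable ℝ fun W => expect R (f W) := by
  unfold expect
  fun_prop

theorem hasDerivAt_expect (R : stdSimplex ℝ A) {f : ℝ → A → ℝ} {f' : A → ℝ} {t : ℝ}
    (hf : ∀ a, HasDerivAt (fun t => f t a) (f' a) t) :
    HasDerivAt (fun t => expect R (f t)) (expect R f') t := by
  unfold expect
  exact HasDerivAt.fun_sum fun a _ => (hf a).const_mul (R a)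

end Expect

/-! ### The gradient of the regularized loss, and the two estimates linking it to the excess loss.
-/

namespace FeatureMaps

variable {I S : Type*} [Fintype S] [Nonempty S] {L : I → S → ℝ} (F : FeatureMaps L)

theorem expFam_eq_gibbs (W : F.Param) (i : I) : F.expFam W i = gibbs (F.score W i) := rfl

theorem score_add (W G : F.Param) (i : I) (s : S) :
    F.score (W + G) i s = F.score W i s + F.score G i s := bilin_add _ _ _ _

theorem score_smul (c : ℝ) (W : F.Param) (i : I) (s : S) :
    F.score (c • W) i s = c * F.score W i s := bilin_smul _ _ _ _

theorem score_sub (W G : F.Param) (i : I) (s : S) :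
    F.score (W - G) i s = F.score W i s - F.score G i s := by
  rw [sub_eq_add_neg, ← neg_one_smul ℝ G, score_add, score_smul]; ring

theorem differentiable_score (i : I) (s : S) : Differentiable ℝ fun W => F.score W i s :=
  differentiable_bilin _ _

theorem C_nonneg : 0 ≤ F.C := (norm_nonneg _).trans F.norm_M_le

theorem abs_score_le (W : F.Param) (i : I) (s : S) :
    |F.score W i s| ≤ ‖contract W (F.psiI i)‖ * F.DS := by
  rw [score, bilin_eq_inner]
  exact (abs_real_inner_le_norm _ _).trans
    (mul_le_mul_of_nonneg_left (F.norm_psiS_le s) (norm_nonneg _))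

theorem norm_contract_psiI_le (W : F.Param) (i : I) : ‖contract W (F.psiI i)‖ ≤ ‖W‖ * F.DI :=
  (norm_contract_le _ _).trans (mul_le_mul_of_nonneg_left (F.norm_psiI_le i) (norm_nonneg _))

theorem abs_score_le_norm (W : F.Param) (i : I) (s : S) :
    |F.score W i s| ≤ ‖W‖ * (F.DI * F.DS) := by
  rw [← mul_assoc]
  exact (F.abs_score_le W i s).trans
    (mul_le_mul_of_nonneg_right (F.norm_contract_psiI_le W i) F.DS_pos.le)

theorem abs_cost_le (i : I) (s : S) : |L i s| ≤ F.C * (F.DI * F.DS) := by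
  rw [F.cost_eq]
  exact (F.abs_score_le_norm F.M i s).trans
    (mul_le_mul_of_nonneg_right F.norm_M_le (mul_pos F.DI_pos F.DS_pos).le)

theorem norm_contract_sq_le_variance (W : F.Param) (i : I) :
    F.α * ‖contract W (F.psiI i)‖ ^ 2 ≤ variance (uniform S) (F.score W i) := by
  have h : F.score W i = fun s => inner ℝ (contract W (F.psiI i)) (F.psiS s) :=
    funext fun s => bilin_eq_inner _ _ _
  rw [h]
  exact F.variance_ge _

/-- The cost plus `lam` times the score of `W` is `lam` times the score of `W + M / lam`. -/
theorem cost_add_score {lam : ℝ} (hlam : 0 < lam) (W : F.Param) (i : I) (s : S) :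
    L i s + lam * F.score W i s = lam * F.score (W - -(1 / lam) • F.M) i s := by
  rw [score_sub, score_smul, F.cost_eq]
  change F.score F.M i s + _ = _
  field_simp
  ring

variable [Fintype I] (R : stdSimplex ℝ I) (β ρ : Set.Ioo (0 : ℝ) 1) (lam : ℝ)

theorem loss_eq (W : F.Param) : F.loss R β ρ W = expect R fun i =>
    (1 - β.1) * expect (gibbs (F.score W i)) (L i) +
      β.1 * expect (gibbs (F.score (ρ.1 • W) i)) (L i) := by
  simp only [loss, genLoss, mixture, expect_mix, expFam_eq_gibbs]

theorem differentiable_loss : Differentiable ℝ (F.loss R β ρ) := by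
  rw [show F.loss R β ρ = _ from funext (F.loss_eq R β ρ)]
  refine differentiable_expect R fun i => ?_
  refine Differentiable.add (Differentiable.const_mul ?_ _) (Differentiable.const_mul ?_ _)
  · exact differentiable_expect_gibbs (F.differentiable_score i) fun s => differentiable_const _
  · refine differentiable_expect_gibbs (fun s => ?_) fun s => differentiable_const _
    exact (F.differentiable_score i s).comp (differentiable_id.const_smul ρ.1)

theorem differentiable_negEntropy : Differentiable ℝ (F.negEntropy R) :=
  differentiable_expect R fun i => differentiable_expect_log_gibbs (F.differentiable_score i)

theorem differentiable_regLoss : Differentiable ℝ (F.regLoss R β ρ lam) := by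
  unfold regLoss regularizer
  have h1 := F.differentiable_negEntropy R
  exact (F.differentiable_loss R β ρ).add (((h1.const_mul _).add
    ((h1.comp (differentiable_id.const_smul ρ.1)).const_mul _)).const_mul _)

/-- The derivative of the regularized loss at `W` in direction `G` is a covariance of the scores
of `G` and of `W + M / lam`. -/
theorem inner_gradient_regLoss {lam : ℝ} (hlam : 0 < lam) (W G : F.Param) :
    inner ℝ G (gradient (F.regLoss R β ρ lam) W) = lam * expect R fun i =>
      (1 - β.1) * cov (gibbs (F.score W i)) (F.score (W - -(1 / lam) • F.M) i) (F.score G i) +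
      β.1 * ρ.1 * cov (gibbs (F.score (ρ.1 • W) i)) (F.score (W - -(1 / lam) • F.M) i)
        (F.score G i) := by
  have h1 : HasDerivAt (fun t : ℝ => F.regLoss R β ρ lam (W + t • G))
      (inner ℝ G (gradient (F.regLoss R β ρ lam) W)) 0 := by
    have := ((F.differentiable_regLoss R β ρ lam W).hasFDerivAt).hasLineDerivAt G
    rw [inner_gradient_right]
    exact this
  refine h1.unique ?_
  have hρ : ρ.1 ≠ 0 := ρ.2.1.ne'
  have hL : ∀ (μ : stdSimplex ℝ S) i, lam * cov μ (F.score (W - -(1 / lam) • F.M) i) (F.score G i) =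
      cov μ (L i) (F.score G i) + lam * cov μ (F.score W i) (F.score G i) := fun μ i => by
    rw [← cov_const_mul_left, ← cov_const_mul_left, ← cov_add_left]
    simp only [← F.cost_add_score hlam]
  have hs : ∀ (t : ℝ) i, F.score (W + t • G) i = fun s => F.score W i s + t * F.score G i s :=
    fun t i => by funext s; rw [score_add, score_smul]
  -- The slow component moves `ρ` times as fast, so its direction of motion is the score of `G`
  -- scaled by `ρ`.
  have hs' : ∀ (t : ℝ) i, F.score (ρ.1 • (W + t • G)) i =
      fun s => F.score (ρ.1 • W) i s + t * (ρ.1 * F.score G i s) := fun t i => by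
    funext s; rw [score_smul, score_smul, score_add, score_smul]; ring
  have hr : ∀ i, F.score (ρ.1 • W) i = fun s => ρ.1 * F.score W i s := fun i => by
    funext s; rw [score_smul]
  simp only [regLoss, regularizer, negEntropy, loss_eq, expFam_eq_gibbs, hs, hs']
  have hA := hasDerivAt_expect R (t := 0) fun i =>
    ((hasDerivAt_expect_gibbs (F.score W i) (F.score G i) (L i) 0).const_mul (1 - β.1)).add
    ((hasDerivAt_expect_gibbs (F.score (ρ.1 • W) i) (fun s => ρ.1 * F.score G i s) (L i)
      0).const_mul β.1)
  have hB := hasDerivAt_expect R (t := 0) fun i =>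
    hasDerivAt_expect_log_gibbs (F.score W i) (F.score G i) 0
  have hC := hasDerivAt_expect R (t := 0) fun i =>
    hasDerivAt_expect_log_gibbs (F.score (ρ.1 • W) i) (fun s => ρ.1 * F.score G i s) 0
  have hD := hA.add (((hB.const_mul (1 - β.1)).add (hC.const_mul (β.1 / ρ.1))).const_mul lam)
  refine HasDerivAt.congr_deriv hD ?_
  simp only [zero_mul, add_zero, ← expect_const_mul, ← expect_add]
  congr 1
  funext i
  have hc : cov (gibbs (F.score (ρ.1 • W) i)) (F.score (ρ.1 • W) i) (F.score G i) =
      ρ.1 * cov (gibbs (F.score (ρ.1 • W) i)) (F.score W i) (F.score G i) := by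
    rw [← cov_const_mul_left]
    congr 1
    exact hr i
  -- Why the slow entropy has weight `β / ρ`: its covariance carries two factors `ρ`, that of the
  -- slow loss only one. With this weight both have coefficient `β * ρ` and combine through `hL`.
  have hβρ : β.1 / ρ.1 * ρ.1 = β.1 := div_mul_cancel₀ _ hρ
  rw [cov_const_mul_right, cov_const_mul_right, hc]
  linear_combination -(1 - β.1) * hL (gibbs (F.score W i)) i -
    β.1 * ρ.1 * hL (gibbs (F.score (ρ.1 • W) i)) i +
    lam * ρ.1 * cov (gibbs (F.score (ρ.1 • W) i)) (F.score W i) (F.score G i) * hβρ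

/-- The slow component alone gives this bound: its scores are at most 1 in absolute value, so it
inherits the uniform variance up to `exp (-2)`. -/
theorem mul_expect_norm_sq_le_inner_gradient {lam : ℝ} (hlam : 0 < lam) (W : F.Param)
    (hW : ρ.1 * ‖W‖ * (F.DI * F.DS) ≤ 1) :
    lam * β.1 * ρ.1 * Real.exp (-2) * F.α *
        expect R (fun i => ‖contract (W - -(1 / lam) • F.M) (F.psiI i)‖ ^ 2) ≤
      inner ℝ (W - -(1 / lam) • F.M) (gradient (F.regLoss R β ρ lam) W) := by
  rw [inner_gradient_regLoss F R β ρ hlam, mul_assoc lam, mul_assoc lam, mul_assoc lam,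
    mul_assoc lam, ← expect_const_mul]
  refine mul_le_mul_of_nonneg_left (expect_mono R fun i => ?_) hlam.le
  rw [← variance_eq_cov, ← variance_eq_cov]
  set G := W - -(1 / lam) • F.M
  have h1 : ∀ s, |F.score (ρ.1 • W) i s| ≤ 1 := fun s => by
    refine (F.abs_score_le_norm _ i s).trans ?_
    rwa [norm_smul, Real.norm_of_nonneg ρ.2.1.le]
  have h2 := mul_variance_le (gibbs (F.score (ρ.1 • W) i)) (uniform S) (Real.exp_pos _).le
    (mul_uniform_le_gibbs h1) (F.score G i)
  have h3 := mul_le_mul_of_nonneg_left (F.norm_contract_sq_le_variance G i)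
    (Real.exp_pos (-(2 * 1))).le
  have h4 := variance_nonneg (gibbs (F.score W i)) (F.score G i)
  have h5 := mul_le_mul_of_nonneg_left (h3.trans h2) (mul_pos β.2.1 ρ.2.1).le
  have h6 := mul_nonneg (sub_nonneg.2 β.2.2.le) h4
  rw [mul_one] at h5
  linarith

/-- Pair the gradient with itself: the covariances are linear in its norm, which then cancels. -/
theorem norm_gradient_regLoss_le {lam : ℝ} (hlam : 0 < lam) (W : F.Param) :
    ‖gradient (F.regLoss R β ρ lam) W‖ ≤
      lam * (2 * (‖W - -(1 / lam) • F.M‖ * (F.DI * F.DS) * (F.DI * F.DS))) := by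
  set v := gradient (F.regLoss R β ρ lam) W with hv
  set K := ‖W - -(1 / lam) • F.M‖ * (F.DI * F.DS) with hK
  have hDD := mul_pos F.DI_pos F.DS_pos
  have hK0 : 0 ≤ K := mul_nonneg (norm_nonneg _) hDD.le
  have h1 : inner ℝ v v ≤ lam * (2 * (K * (‖v‖ * (F.DI * F.DS)))) := by
    conv_lhs => rw [hv, inner_gradient_regLoss F R β ρ hlam]
    refine mul_le_mul_of_nonneg_left ((le_abs_self _).trans (abs_expect_le R fun i => ?_)) hlam.le
    have hc : ∀ μ : stdSimplex ℝ S, |cov μ (F.score (W - -(1 / lam) • F.M) i) (F.score v i)| ≤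
        2 * (K * (‖v‖ * (F.DI * F.DS))) := fun μ =>
      abs_cov_le μ hK0 (F.abs_score_le_norm _ i) (F.abs_score_le_norm _ i)
    have hb1 := sub_nonneg.2 β.2.2.le
    have hbr := mul_pos β.2.1 ρ.2.1
    refine (abs_add_le _ _).trans ?_
    rw [abs_mul, abs_mul, abs_of_nonneg hb1, abs_of_pos hbr]
    have hX : 0 ≤ 2 * (K * (‖v‖ * (F.DI * F.DS))) := by positivity
    have h2 := mul_le_mul_of_nonneg_left (hc (gibbs (F.score W i))) hb1
    have h3 := mul_le_mul_of_nonneg_left (hc (gibbs (F.score (ρ.1 • W) i))) hbr.le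
    have h4 : β.1 * ρ.1 ≤ β.1 := mul_le_of_le_one_right β.2.1.le ρ.2.2.le
    have h5 := mul_le_mul_of_nonneg_right h4 hX
    linarith
  rw [real_inner_self_eq_norm_sq] at h1
  rcases (norm_nonneg v).eq_or_lt with h0 | h0
  · rw [← h0]; positivity
  · refine le_of_mul_le_mul_right ?_ h0
    linarith

/-- The distance is measured through `(W - W')ᵀ z` averaged over the prior, since the gradient
correlation controls only this and not `‖W - W'‖`. -/
theorem loss_le_add (W W' : F.Param) :
    F.loss R β ρ W ≤ F.loss R β ρ W' + 2 * (F.C * (F.DI * F.DS) * F.DS) *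
      expect R fun i => ‖contract (W - W') (F.psiI i)‖ := by
  rw [loss_eq, loss_eq, ← expect_const_mul, ← expect_add]
  refine expect_mono R fun i => ?_
  have ha : 0 ≤ F.C * (F.DI * F.DS) := mul_nonneg F.C_nonneg (mul_pos F.DI_pos F.DS_pos).le
  have h0 : ∀ s, |F.score W i s - F.score W' i s| ≤ ‖contract (W - W') (F.psiI i)‖ * F.DS :=
    fun s => by rw [← score_sub]; exact F.abs_score_le _ i s
  have h0' : ∀ s, |F.score (ρ.1 • W) i s - F.score (ρ.1 • W') i s| ≤
      ‖contract (W - W') (F.psiI i)‖ * F.DS := fun s => by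
    rw [score_smul, score_smul, ← mul_sub, abs_mul, abs_of_pos ρ.2.1]
    exact (mul_le_of_le_one_left (abs_nonneg _) ρ.2.2.le).trans (h0 s)
  have h1 := (le_abs_self _).trans (abs_expect_gibbs_sub_le _ _ _ ha (F.abs_cost_le i) h0)
  have h2 := (le_abs_self _).trans (abs_expect_gibbs_sub_le _ _ _ ha (F.abs_cost_le i) h0')
  have h3 := mul_le_mul_of_nonneg_left h1 (sub_nonneg.2 β.2.2.le)
  have h4 := mul_le_mul_of_nonneg_left h2 β.2.1.le
  linarith

/-- The loss of `-M / lam` is optimal up to the entropy and the weight of the slow component. -/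
theorem loss_le_opt {lam : ℝ} (hlam : 0 < lam) :
    F.loss R β ρ (-(1 / lam) • F.M) ≤
      opt R L + (lam * Real.log (Fintype.card S) + 2 * β.1 * (F.C * (F.DI * F.DS))) := by
  rw [loss_eq, opt, ← expect_const R (lam * Real.log (Fintype.card S) + _), ← expect_add]
  refine expect_mono R fun i => ?_
  obtain ⟨s₀, hs₀⟩ := exists_eq_ciInf_of_finite (f := L i)
  have hs : F.score (-(1 / lam) • F.M) i = fun s => -(1 / lam) * L i s := by
    funext s; rw [score_smul, F.cost_eq]; rfl
  have h1 := expect_gibbs_le (L i) hlam s₀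
  rw [← hs, hs₀] at h1
  have h2 := (abs_le.1 (abs_expect_le (gibbs (F.score (ρ.1 • -(1 / lam) • F.M) i))
    (F.abs_cost_le i))).2
  have h3 := (abs_le.1 (F.abs_cost_le i s₀)).1
  rw [hs₀] at h3
  have hlog : 0 ≤ lam * Real.log (Fintype.card S) :=
    mul_nonneg hlam.le (Real.log_natCast_nonneg _)
  have h4 := mul_le_mul_of_nonneg_left h1 (sub_nonneg.2 β.2.2.le)
  have h5 := mul_le_mul_of_nonneg_left h2 β.2.1.le
  have h6 := mul_le_mul_of_nonneg_left h3 β.2.1.le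
  have h7 := mul_nonneg β.2.1.le hlog
  linarith

end FeatureMaps

/-! ### Bit descriptions of Euclidean balls. -/

section Description

/-- Each used bit string decodes to a chosen member of its fibre in `𝒲`, unused strings to a default
member; fibres have diameter at most `δ`. -/
theorem describedUpTo_of_encoding {E A : Type*} [NormedAddCommGroup E] [Fintype A] {𝒲 : Set E}
    (hne : 𝒲.Nonempty) {δ : ℝ} {b : ℕ} (hA : Fintype.card A ≤ 2 ^ b) (enc : E → A)
    (h : ∀ x ∈ 𝒲, ∀ y ∈ 𝒲, enc x = enc y → ‖x - y‖ ≤ δ) : DescribedUpTo 𝒲 δ b := by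
  classical
  obtain ⟨e⟩ := Function.Embedding.nonempty_of_card_le (α := A) (β := Fin b → Bool) (by simpa)
  obtain ⟨w, hw⟩ := hne
  refine ⟨fun c => if hc : ∃ x ∈ 𝒲, e (enc x) = c then hc.choose else w, fun c => ?_,
    fun x hx => ⟨e (enc x), ?_⟩⟩
  · by_cases hc : ∃ x ∈ 𝒲, e (enc x) = c
    · simpa only [dif_pos hc] using hc.choose_spec.1
    · simpa only [dif_neg hc] using hw
  · have hc : ∃ y ∈ 𝒲, e (enc y) = e (enc x) := ⟨x, hx, rfl⟩
    simp only [dif_pos hc]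
    exact h x hx _ hc.choose_spec.1 (e.injective hc.choose_spec.2.symm)

theorem describedUpTo_closedBall {ι : Type*} [Fintype ι] {B δ : ℝ} (hB : 0 ≤ B) (hδ : 0 < δ)
    {k : ℕ} (hk : 2 * B * (Fintype.card ι + 1) / δ + 1 ≤ 2 ^ k) :
    DescribedUpTo (Metric.closedBall (0 : EuclideanSpace ℝ ι) B) δ (Fintype.card ι * k) := by
  classical
  set d := Fintype.card ι
  -- Grid width per coordinate: `d * r ^ 2 ≤ δ ^ 2` without square roots, and `d + 1` also covers
  -- dimension zero.
  set r : ℝ := δ / (d + 1) with hr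
  have hd : (0 : ℝ) ≤ d := Nat.cast_nonneg _
  have hr0 : 0 < r := by positivity
  have hcoord : ∀ x ∈ Metric.closedBall (0 : EuclideanSpace ℝ ι) B, ∀ i, |x i| ≤ B :=
    fun x hx i => (PiLp.norm_apply_le x i).trans (mem_closedBall_zero_iff.1 hx)
  have hpos : ∀ x ∈ Metric.closedBall (0 : EuclideanSpace ℝ ι) B, ∀ i, 0 ≤ (x i + B) / r :=
    fun x hx i => div_nonneg (by linarith [(abs_le.1 (hcoord x hx i)).1]) hr0.le
  have hlt : ∀ x ∈ Metric.closedBall (0 : EuclideanSpace ℝ ι) B, ∀ i,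
      ⌊(x i + B) / r⌋₊ < 2 ^ k := fun x hx i => by
    rw [Nat.floor_lt (hpos x hx i)]
    have h1 : (x i + B) / r ≤ 2 * B / r :=
      div_le_div_of_nonneg_right (by linarith [(abs_le.1 (hcoord x hx i)).2]) hr0.le
    have h2 : 2 * B / r = 2 * B * (d + 1) / δ := by rw [hr]; field_simp
    push_cast
    linarith
  refine describedUpTo_of_encoding (A := ι → Fin (2 ^ k)) ⟨0, by simpa⟩ ?_
    -- `Fin.ofNat` reduces modulo `2 ^ k`; by `hlt` this changes nothing on the ball.
    (fun x i => Fin.ofNat (2 ^ k) ⌊(x i + B) / r⌋₊) fun x hx y hy hxy => ?_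
  · simp [d, ← pow_mul, mul_comm]
  · have hi : ∀ i, (x i - y i) ^ 2 ≤ r ^ 2 := fun i => by
      have h1 := congrArg Fin.val (congrFun hxy i)
      simp only [Fin.val_ofNat] at h1
      rw [Nat.mod_eq_of_lt (hlt x hx i), Nat.mod_eq_of_lt (hlt y hy i)] at h1
      have h2 := Nat.floor_le (hpos x hx i)
      have h3 := Nat.lt_floor_add_one ((x i + B) / r)
      have h4 := Nat.floor_le (hpos y hy i)
      have h5 := Nat.lt_floor_add_one ((y i + B) / r)
      rw [h1] at h2 h3
      have h6 : (x i - y i) / r = (x i + B) / r - (y i + B) / r := by ring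
      have h7 : |(x i - y i) / r| ≤ 1 := by
        rw [h6, abs_le]; constructor <;> linarith
      rw [abs_div, abs_of_pos hr0, div_le_one hr0] at h7
      exact sq_le_sq' (by linarith [neg_abs_le (x i - y i)]) ((le_abs_self _).trans h7)
    refine le_of_sq_le_sq ?_ hδ.le
    rw [EuclideanSpace.real_norm_sq_eq]
    calc ∑ i, (x - y) i ^ 2 ≤ ∑ _i : ι, r ^ 2 := Finset.sum_le_sum fun i _ => hi i
      _ = d * r ^ 2 := by simp [d]
      _ ≤ (d + 1) ^ 2 * r ^ 2 := by gcongr; nlinarith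
      _ = δ ^ 2 := by rw [hr]; field_simp

theorem exists_two_pow_ge {X : ℝ} (hX : 1 ≤ X) :
    ∃ k : ℕ, X ≤ 2 ^ k ∧ (k : ℝ) ≤ 2 * Real.log X + 1 := by
  have hX0 : 0 < X := by linarith
  have hl2 : 1 / 2 < Real.log 2 := by linarith [Real.log_two_gt_d9]
  have hlX := Real.log_nonneg hX
  refine ⟨⌈Real.log X / Real.log 2⌉₊, ?_, ?_⟩
  · have h1 := Nat.le_ceil (Real.log X / Real.log 2)
    rw [div_le_iff₀ (by linarith), ← Real.log_pow] at h1
    exact (Real.log_le_log_iff hX0 (by positivity)).1 h1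
  · have h1 := Nat.ceil_lt_add_one (div_nonneg hlX (by linarith : (0 : ℝ) ≤ Real.log 2))
    have h2 : Real.log X / Real.log 2 ≤ 2 * Real.log X := by
      rw [div_le_iff₀ (by linarith)]
      nlinarith
    linarith

/-- A ball whose radius is at most `A / ε` is described by `O (d (A + log (1/ε) + log (1/δ)))`
bits, for `d` polynomial in `A`. -/
theorem describedUpTo_closedBall_log {ι : Type*} [Fintype ι] {B δ ε A : ℝ} (hB : 0 ≤ B)
    (hε : 0 < ε) (hδ : 0 < δ) (hA : 2 * (B * ε) * (Fintype.card ι + 1) + 1 ≤ A) :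
    ∃ b : ℕ, DescribedUpTo (Metric.closedBall (0 : EuclideanSpace ℝ ι) B) δ b ∧
      (b : ℝ) ≤ Fintype.card ι *
        (2 * (A + Real.log (1 + 1 / ε) + Real.log (1 + 1 / δ)) + 1) := by
  have hd : (0 : ℝ) ≤ Fintype.card ι := Nat.cast_nonneg _
  set Y : ℝ := 2 * (B * ε) * (Fintype.card ι + 1) with hY
  have hY0 : 0 ≤ Y := by positivity
  have hu : 0 < 1 / ε := by positivity
  have hv : 0 < 1 / δ := by positivity
  -- `Y` involves only `B * ε`, so `ε` and `δ` enter the bit count through their own logarithms.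
  have hXY : 2 * B * (Fintype.card ι + 1) / δ + 1 = Y * (1 / ε) * (1 / δ) + 1 := by
    rw [hY]; field_simp
  have hX1 : 1 ≤ 2 * B * (Fintype.card ι + 1) / δ + 1 := by
    rw [hXY]; have : 0 ≤ Y * (1 / ε) * (1 / δ) := by positivity
    linarith
  obtain ⟨k, hk, hk'⟩ := exists_two_pow_ge hX1
  refine ⟨_, describedUpTo_closedBall hB hδ hk, ?_⟩
  push_cast
  refine mul_le_mul_of_nonneg_left (hk'.trans ?_) hd
  have hA0 : 0 < A := by linarith
  have hle : 2 * B * (Fintype.card ι + 1) / δ + 1 ≤ A * (1 + 1 / ε) * (1 + 1 / δ) := by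
    rw [hXY]
    calc Y * (1 / ε) * (1 / δ) + 1 ≤ (Y + 1) * (1 + 1 / ε) * (1 + 1 / δ) := by
          have h1 := mul_nonneg hY0 hu.le
          have h2 := mul_nonneg hY0 hv.le
          have h3 := mul_nonneg hu.le hv.le
          nlinarith
      _ ≤ _ := by gcongr
  have hlog := Real.log_le_log (by linarith) hle
  rw [Real.log_mul (by positivity) (by positivity), Real.log_mul (by positivity) (by positivity)]
    at hlog
  linarith [Real.log_le_sub_one_of_pos hA0]

end Description

section Parameters

/-! The choice of the parameters in terms of a common bound `P` on all complexity measures. -/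

/-- Weight of the slow component. -/
noncomputable def slowWeight (P ε : ℝ) : ℝ := 1 / (4 * P ^ 3 / ε + 2)

/-- Weight of the entropy. -/
noncomputable def entropyWeight (P ε : ℝ) : ℝ := ε / (2 * P)

/-- Radius of the parameter set. -/
noncomputable def radius (P ε : ℝ) : ℝ := 2 * P ^ 2 / ε

/-- Slowdown of the slow component. -/
noncomputable def slowScale (P ε : ℝ) : ℝ := 1 / (radius P ε * P ^ 2 + 2)

/-- The factor by which the gradient correlation dominates the excess loss. -/
noncomputable def correlationFactor (P ε : ℝ) : ℝ :=
  (2 * P ^ 4) ^ 2 / (2 * ε) *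
    (9 * P * (1 / entropyWeight P ε) * (1 / slowWeight P ε) * (1 / slowScale P ε))

theorem one_div_add_two_mem_Ioo {x : ℝ} (hx : 0 ≤ x) : 1 / (x + 2) ∈ Set.Ioo (0 : ℝ) 1 :=
  ⟨by positivity, by rw [div_lt_one (by positivity)]; linarith⟩

theorem radius_pos {P ε : ℝ} (hP : 1 ≤ P) (hε : 0 < ε) : 0 < radius P ε := by
  unfold radius; positivity

theorem slowWeight_mem_Ioo {P ε : ℝ} (hP : 1 ≤ P) (hε : 0 < ε) :
    slowWeight P ε ∈ Set.Ioo (0 : ℝ) 1 :=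
  one_div_add_two_mem_Ioo (by positivity)

theorem slowScale_mem_Ioo {P ε : ℝ} (hP : 1 ≤ P) (hε : 0 < ε) :
    slowScale P ε ∈ Set.Ioo (0 : ℝ) 1 :=
  one_div_add_two_mem_Ioo (mul_nonneg (radius_pos hP hε).le (by positivity))

theorem entropyWeight_pos {P ε : ℝ} (hP : 1 ≤ P) (hε : 0 < ε) : 0 < entropyWeight P ε := by
  unfold entropyWeight; positivity

theorem correlationFactor_pos {P ε : ℝ} (hP : 1 ≤ P) (hε : 0 < ε) :
    0 < correlationFactor P ε := by
  have h1 := entropyWeight_pos hP hε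
  have h2 := (slowWeight_mem_Ioo hP hε).1
  have h3 := (slowScale_mem_Ioo hP hε).1
  unfold correlationFactor; positivity

end Parameters

/-! ### The three requirements under a common bound `P`. -/

namespace FeatureMaps

variable {I S : Type*} [Fintype S] [Nonempty S] {L : I → S → ℝ}

/-- All complexity measures of the feature maps and of the solutions are bounded by `P`. -/
structure BoundedBy (F : FeatureMaps L) (P : ℝ) : Prop where
  one_le : 1 ≤ P
  nX_le : (F.nX : ℝ) ≤ P
  nZ_le : (F.nZ : ℝ) ≤ P
  DS_le : F.DS ≤ P
  DI_le : F.DI ≤ P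
  C_le : F.C ≤ P
  one_le_α_mul : 1 ≤ F.α * P
  log_card_le : Real.log (Fintype.card S) ≤ P

namespace BoundedBy

variable {F : FeatureMaps L} {P ε : ℝ} (hF : F.BoundedBy P) (hε : 0 < ε)
include hF

theorem DI_mul_DS_le : F.DI * F.DS ≤ P ^ 2 := by
  rw [sq]
  exact mul_le_mul hF.DI_le hF.DS_le F.DS_pos.le (by linarith [hF.one_le])

theorem C_mul_le : F.C * (F.DI * F.DS) ≤ P ^ 3 := by
  have := hF.one_le
  calc F.C * (F.DI * F.DS) ≤ P * P ^ 2 :=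
        mul_le_mul hF.C_le hF.DI_mul_DS_le (mul_pos F.DI_pos F.DS_pos).le (by linarith)
    _ = P ^ 3 := by ring

theorem finrank_le : (Module.finrank ℝ F.Param : ℝ) ≤ P ^ 2 := by
  have := hF.one_le
  simp only [finrank_euclideanSpace, Fintype.card_prod, Fintype.card_fin, Nat.cast_mul, sq]
  exact mul_le_mul hF.nZ_le hF.nX_le (Nat.cast_nonneg _) (by linarith)

include hε

theorem optimum_mem : -(1 / entropyWeight P ε) • F.M ∈
    Metric.closedBall (0 : F.Param) (radius P ε) := by
  have hP := hF.one_le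
  have hl := entropyWeight_pos hP hε
  rw [mem_closedBall_zero_iff, norm_smul, norm_neg, Real.norm_of_nonneg (by positivity)]
  calc 1 / entropyWeight P ε * ‖F.M‖ ≤ 1 / entropyWeight P ε * P := by
        gcongr; exact F.norm_M_le.trans hF.C_le
    _ = radius P ε := by unfold entropyWeight radius; field_simp

theorem exists_describedUpTo {δ : ℝ} (hδ : 0 < δ) :
    ∃ b : ℕ, DescribedUpTo (Metric.closedBall (0 : F.Param) (radius P ε)) δ b ∧
      (b : ℝ) ≤ P ^ 2 * (2 * (4 * P ^ 2 * (P ^ 2 + 1) + 1 + Real.log (1 + 1 / ε) +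
        Real.log (1 + 1 / δ)) + 1) := by
  have hP := hF.one_le
  have hcard := hF.finrank_le
  rw [finrank_euclideanSpace] at hcard
  have hrad : radius P ε * ε = 2 * P ^ 2 := by unfold radius; field_simp
  obtain ⟨b, hb, hb'⟩ := describedUpTo_closedBall_log (ι := Fin F.nZ × Fin F.nX)
    (A := 4 * P ^ 2 * (P ^ 2 + 1) + 1) (radius_pos hP hε).le hε hδ (by
      rw [hrad]
      have := mul_le_mul_of_nonneg_left hcard (by positivity : 0 ≤ 4 * P ^ 2)
      linarith)
  refine ⟨b, hb, hb'.trans (mul_le_mul_of_nonneg_right hcard ?_)⟩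
  have h1 : 0 ≤ Real.log (1 + 1 / ε) := Real.log_nonneg (by simp [hε.le])
  have h2 : 0 ≤ Real.log (1 + 1 / δ) := Real.log_nonneg (by simp [hδ.le])
  positivity

variable [Fintype I] (R : stdSimplex ℝ I) (β ρ : Set.Ioo (0 : ℝ) 1)

theorem completeAt (hβ : β.1 = slowWeight P ε) :
    CompleteAt (Metric.closedBall (0 : F.Param) (radius P ε)) (F.loss R β ρ) (opt R L) ε
      (-(1 / entropyWeight P ε) • F.M) := by
  have hP := hF.one_le
  have hl := entropyWeight_pos hP hε
  refine ⟨hF.optimum_mem hε, (F.loss_le_opt R β ρ hl).trans ?_⟩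
  have h1 : entropyWeight P ε * Real.log (Fintype.card S) ≤ ε / 2 := by
    calc _ ≤ entropyWeight P ε * P := mul_le_mul_of_nonneg_left hF.log_card_le hl.le
      _ = ε / 2 := by unfold entropyWeight; field_simp
  have h2 : 2 * β.1 * (F.C * (F.DI * F.DS)) ≤ ε / 2 := by
    calc _ ≤ 2 * β.1 * P ^ 3 :=
          mul_le_mul_of_nonneg_left hF.C_mul_le (by linarith [β.2.1])
      _ ≤ ε / 2 := by
        rw [hβ, slowWeight, mul_one_div, div_mul_eq_mul_div, div_le_iff₀ (by positivity)]
        have : ε / 2 * (4 * P ^ 3 / ε + 2) = 2 * P ^ 3 + ε := by field_simp; ring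
        linarith
  linarith

theorem norm_gradient_le {W : F.Param}
    (hW : W ∈ Metric.closedBall (0 : F.Param) (radius P ε)) :
    ‖gradient (F.regLoss R β ρ (entropyWeight P ε)) W‖ ≤ 4 * P ^ 5 := by
  have hP := hF.one_le
  have hl := entropyWeight_pos hP hε
  have hr := radius_pos hP hε
  have hD := hF.DI_mul_DS_le
  have hD0 := (mul_pos F.DI_pos F.DS_pos).le
  have h1 : ‖W - -(1 / entropyWeight P ε) • F.M‖ ≤ 2 * radius P ε := by
    have h2 := hF.optimum_mem hε
    rw [mem_closedBall_zero_iff] at hW h2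
    exact (norm_sub_le _ _).trans (by linarith)
  refine (F.norm_gradient_regLoss_le R β ρ hl W).trans ?_
  calc _ ≤ entropyWeight P ε * (2 * (2 * radius P ε * P ^ 2 * P ^ 2)) := by gcongr
    -- The entropy weight is proportional to `ε` and the radius to `1 / ε`, so the gradient bound is
    -- free of `ε`.
    _ = 4 * P ^ 5 := by unfold entropyWeight radius; field_simp; ring

theorem loss_le (hβ : β.1 = slowWeight P ε) (hρ : ρ.1 = slowScale P ε) {W : F.Param}
    (hW : W ∈ Metric.closedBall (0 : F.Param) (radius P ε)) :
    F.loss R β ρ W ≤ F.loss R β ρ (-(1 / entropyWeight P ε) • F.M) + ε / 2 +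
      correlationFactor P ε * inner ℝ (W - -(1 / entropyWeight P ε) • F.M)
        (gradient (F.regLoss R β ρ (entropyWeight P ε)) W) := by
  have hP := hF.one_le
  have hl := entropyWeight_pos hP hε
  have hr := radius_pos hP hε
  have hD := hF.DI_mul_DS_le
  have hD0 := mul_pos F.DI_pos F.DS_pos
  have hβ0 := β.2.1
  have hρ0 := ρ.2.1
  set lam := entropyWeight P ε with hlam
  set G := W - -(1 / lam) • F.M with hG
  set a : I → ℝ := fun i => ‖contract G (F.psiI i)‖ with ha
  -- `slowScale` is chosen so that this holds on the whole parameter ball.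
  have hscale : ρ.1 * ‖W‖ * (F.DI * F.DS) ≤ 1 := by
    rw [mem_closedBall_zero_iff] at hW
    calc ρ.1 * ‖W‖ * (F.DI * F.DS) ≤ ρ.1 * radius P ε * P ^ 2 := by gcongr
      _ ≤ 1 := by
        rw [hρ, slowScale, mul_assoc, one_div_mul_eq_div, div_le_one (by positivity)]
        linarith
  have hcorr := F.mul_expect_norm_sq_le_inner_gradient R β ρ hl W hscale
  have hsq0 : 0 ≤ expect R fun i => a i ^ 2 := by
    rw [← expect_const R 0]
    exact expect_mono R fun i => sq_nonneg _
  have hexp : (1 : ℝ) ≤ 9 * Real.exp (-2) := by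
    have h1 : Real.exp 2 ≤ 9 := by
      have h2 := Real.exp_one_lt_d9
      have h3 : Real.exp 2 = Real.exp 1 ^ 2 := by rw [← Real.exp_nat_mul]; norm_num
      rw [h3]
      nlinarith [Real.exp_pos 1]
    rw [Real.exp_neg, ← div_eq_mul_inv, le_div_iff₀ (Real.exp_pos _)]
    linarith
  have hmean : (expect R fun i => a i ^ 2) ≤ 9 * P * (1 / lam) * (1 / β.1) * (1 / ρ.1) *
      inner ℝ G (gradient (F.regLoss R β ρ lam) W) := by
    calc (expect R fun i => a i ^ 2)
        ≤ (9 * Real.exp (-2)) * (F.α * P) * expect R fun i => a i ^ 2 :=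
          le_mul_of_one_le_left hsq0 (one_le_mul_of_one_le_of_one_le hexp hF.one_le_α_mul)
      _ = 9 * P * (1 / lam) * (1 / β.1) * (1 / ρ.1) * (lam * β.1 * ρ.1 * Real.exp (-2) * F.α *
            expect R fun i => a i ^ 2) := by field_simp
      _ ≤ _ := mul_le_mul_of_nonneg_left hcorr (by positivity)
  have ha0 : 0 ≤ expect R a := by
    rw [← expect_const R 0]
    exact expect_mono R fun i => norm_nonneg _
  have hK : 2 * (F.C * (F.DI * F.DS) * F.DS) ≤ 2 * P ^ 4 := by
    calc _ ≤ 2 * (P ^ 3 * P) := by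
          have := mul_le_mul hF.C_mul_le hF.DS_le F.DS_pos.le (by positivity)
          linarith
      _ = 2 * P ^ 4 := by ring
  -- AM-GM for each instance before averaging; the additive `ε / 2` pays for passing from first to
  -- second moments.
  have hamgm : 2 * P ^ 4 * expect R a ≤ ε / 2 + (2 * P ^ 4) ^ 2 / (2 * ε) *
      expect R fun i => a i ^ 2 := by
    rw [← expect_const_mul, ← expect_const_mul, ← expect_const R (ε / 2), ← expect_add]
    refine expect_mono R fun i => ?_
    have h1 : ε / 2 + (2 * P ^ 4) ^ 2 / (2 * ε) * a i ^ 2 - 2 * P ^ 4 * a i =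
        (ε - 2 * P ^ 4 * a i) ^ 2 / (2 * ε) := by field_simp; ring
    have h2 : 0 ≤ (ε - 2 * P ^ 4 * a i) ^ 2 / (2 * ε) := by positivity
    linarith
  have h1 := F.loss_le_add R β ρ W (-(1 / lam) • F.M)
  have h2 := mul_le_mul_of_nonneg_right hK ha0
  have h3 := mul_le_mul_of_nonneg_left hmean
    (by positivity : 0 ≤ (2 * P ^ 4) ^ 2 / (2 * ε))
  rw [correlationFactor, ← hβ, ← hρ, ← hlam, mul_assoc ((2 * P ^ 4) ^ 2 / (2 * ε))]
  linarith

theorem optimizableByDescent (hβ : β.1 = slowWeight P ε) (hρ : ρ.1 = slowScale P ε) :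
    OptimizableByDescent.{w} (Metric.closedBall (0 : F.Param) (radius P ε)) (F.loss R β ρ)
      (F.regLoss R β ρ (entropyWeight P ε)) (-(1 / entropyWeight P ε) • F.M) ε
      (fun V => ε / (4 * correlationFactor P ε * ((4 * P ^ 5) ^ 2 + V)))
      (fun V => ⌈32 * correlationFactor P ε ^ 2 * radius P ε ^ 2 * ((4 * P ^ 5) ^ 2 + V) /
        ε ^ 2⌉₊ + 1) := by
  have hP := hF.one_le
  exact optimizableByDescent_closedBall (F.differentiable_regLoss R β ρ _)
    (F.differentiable_loss R β ρ).continuous (hF.optimum_mem hε) (correlationFactor_pos hP hε) hε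
    (by positivity) (fun W hW => hF.norm_gradient_le hε R β ρ hW)
    fun W hW => hF.loss_le hε R β ρ hβ hρ hW

end BoundedBy

/-- The added 1 ensures `1 ≤ P`. An encoding in `p(N)` bits gives `log |S| ≤ p(N) log 2`, and `log 2
< 1`. -/
theorem PolyBounded.boundedBy {F : FeatureMaps L} {p : Polynomial ℕ} {N : ℕ}
    (hF : F.PolyBounded p N) (hS : HasDescriptionSize S (p.eval N)) :
    F.BoundedBy (polyAt p N + 1) := by
  have hp : polyAt p N = (p.eval N : ℕ) := by
    simpa [polyAt] using Polynomial.aeval_algebraMap_apply ℝ N p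
  have hp0 : 0 ≤ polyAt p N := by rw [hp]; positivity
  have hα := F.α_pos
  refine ⟨by linarith, by linarith [hF.nX_le], by linarith [hF.nZ_le], by linarith [hF.DS_le],
    by linarith [hF.DI_le], by linarith [hF.C_le], by linarith [hF.one_le], ?_⟩
  obtain ⟨enc, henc⟩ := hS
  have h1 := Fintype.card_le_of_injective enc henc
  simp only [Fintype.card_fun, Fintype.card_bool, Fintype.card_fin] at h1
  have hcard : (0 : ℝ) < Fintype.card S := by exact_mod_cast Fintype.card_pos
  have h2 : Real.log (Fintype.card S) ≤ Real.log (2 ^ p.eval N) :=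
    Real.log_le_log hcard (by exact_mod_cast h1)
  rw [Real.log_pow, ← hp] at h2
  nlinarith [Real.log_two_lt_d9]

end FeatureMaps

/-! ### Evaluation of polynomials with natural coefficients: nonnegative and monotone on `[0, ∞)`.
-/

section Polynomials

theorem polyAt_add (q r : Polynomial ℕ) (x : ℝ) : polyAt (q + r) x = polyAt q x + polyAt r x :=
  map_add _ _ _

theorem polyAt_mul (q r : Polynomial ℕ) (x : ℝ) : polyAt (q * r) x = polyAt q x * polyAt r x :=
  map_mul _ _ _

theorem polyAt_pow (q : Polynomial ℕ) (k : ℕ) (x : ℝ) : polyAt (q ^ k) x = polyAt q x ^ k :=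
  map_pow _ _ _

theorem polyAt_X (x : ℝ) : polyAt Polynomial.X x = x := Polynomial.aeval_X x

theorem polyAt_one (x : ℝ) : polyAt 1 x = 1 := map_one _

theorem polyAt_ofNat (k : ℕ) [k.AtLeastTwo] (x : ℝ) : polyAt ofNat(k) x = ofNat(k) :=
  map_ofNat _ k

theorem polyAt_nonneg (q : Polynomial ℕ) {x : ℝ} (hx : 0 ≤ x) : 0 ≤ polyAt q x := by
  rw [polyAt, Polynomial.aeval_eq_sum_range]
  exact Finset.sum_nonneg fun i _ => by positivity

theorem polyAt_mono (q : Polynomial ℕ) {x y : ℝ} (hx : 0 ≤ x) (hxy : x ≤ y) :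
    polyAt q x ≤ polyAt q y := by
  rw [polyAt, polyAt, Polynomial.aeval_eq_sum_range, Polynomial.aeval_eq_sum_range]
  exact Finset.sum_le_sum fun i _ => by gcongr

end Polynomials

/-! ### Polynomials that mirror the parameter formulas, with `X` in place of `1 / ε` and `V`. -/

section ParameterPolynomials

open Polynomial

/-- Bounds `1 / entropyWeight`. -/
noncomputable def entropyPoly (p : ℕ[X]) : ℕ[X] := 2 * p * X

/-- Bounds `radius`. -/
noncomputable def radiusPoly (p : ℕ[X]) : ℕ[X] := 2 * p ^ 2 * X

/-- Bounds `1 / slowWeight`. -/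
noncomputable def slowWeightPoly (p : ℕ[X]) : ℕ[X] := 4 * p ^ 3 * X + 2

/-- Bounds `1 / slowScale`. -/
noncomputable def slowScalePoly (p : ℕ[X]) : ℕ[X] := radiusPoly p * p ^ 2 + 2

/-- Bounds `correlationFactor`. -/
noncomputable def correlationPoly (p : ℕ[X]) : ℕ[X] :=
  2 * p ^ 8 * X * (9 * p * entropyPoly p * slowWeightPoly p * slowScalePoly p)

/-- Bounds the number of descent steps. -/
noncomputable def stepsPoly (p : ℕ[X]) : ℕ[X] :=
  32 * correlationPoly p ^ 2 * radiusPoly p ^ 2 * ((4 * p ^ 5) ^ 2 + X) * X ^ 2 + 2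

/-- Bounds the number of bits. -/
noncomputable def bitsPoly (p : ℕ[X]) : ℕ[X] :=
  p ^ 2 * (2 * (4 * p ^ 2 * (p ^ 2 + 1) + 1 + X) + 1)

variable {p : ℕ[X]} {P ε x : ℝ} (hP : 1 ≤ P) (hε : 0 < ε) (hPx : P ≤ polyAt p x)
  (hx : 1 / ε ≤ x)
include hP hε hPx hx

theorem one_div_entropyWeight_le : 1 / entropyWeight P ε ≤ polyAt (entropyPoly p) x := by
  simp only [entropyPoly, polyAt_mul, polyAt_ofNat, polyAt_X]
  have h : 1 / entropyWeight P ε = 2 * P * (1 / ε) := by unfold entropyWeight; field_simp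
  rw [h]
  have h0 : 0 < 1 / ε := by positivity
  have hp : 0 ≤ polyAt p x := by linarith
  gcongr

theorem radius_le : radius P ε ≤ polyAt (radiusPoly p) x := by
  simp only [radiusPoly, polyAt_mul, polyAt_pow, polyAt_ofNat, polyAt_X]
  have h : radius P ε = 2 * P ^ 2 * (1 / ε) := by unfold radius; field_simp
  rw [h]
  have h0 : 0 < 1 / ε := by positivity
  have hp : 0 ≤ polyAt p x := by linarith
  gcongr

theorem one_div_slowWeight_le : 1 / slowWeight P ε ≤ polyAt (slowWeightPoly p) x := by
  simp only [slowWeightPoly, polyAt_mul, polyAt_add, polyAt_pow, polyAt_ofNat, polyAt_X]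
  have h : 1 / slowWeight P ε = 4 * P ^ 3 * (1 / ε) + 2 := by
    unfold slowWeight; rw [one_div_one_div]; ring
  rw [h]
  have h0 : 0 < 1 / ε := by positivity
  have hp : 0 ≤ polyAt p x := by linarith
  gcongr

theorem one_div_slowScale_le : 1 / slowScale P ε ≤ polyAt (slowScalePoly p) x := by
  simp only [slowScalePoly, polyAt_mul, polyAt_add, polyAt_pow, polyAt_ofNat]
  rw [slowScale, one_div_one_div]
  have h1 := radius_le hP hε hPx hx
  have h2 := radius_pos hP hε
  have h3 := h2.le.trans h1
  gcongr

theorem correlationFactor_le : correlationFactor P ε ≤ polyAt (correlationPoly p) x := by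
  simp only [correlationPoly, polyAt_mul, polyAt_pow, polyAt_ofNat, polyAt_X]
  have h : (2 * P ^ 4) ^ 2 / (2 * ε) = 2 * P ^ 8 * (1 / ε) := by field_simp
  have h1 := one_div_entropyWeight_le hP hε hPx hx
  have h2 := one_div_slowWeight_le hP hε hPx hx
  have h3 := one_div_slowScale_le hP hε hPx hx
  have h4 := one_div_pos.2 (entropyWeight_pos hP hε)
  have h5 := one_div_pos.2 (slowWeight_mem_Ioo hP hε).1
  have h6 := one_div_pos.2 (slowScale_mem_Ioo hP hε).1
  have h7 : 0 < 1 / ε := by positivity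
  have h8 := h4.le.trans h1
  have h9 := h5.le.trans h2
  have h10 := h7.le.trans hx
  have hp : 0 ≤ polyAt p x := by linarith
  rw [correlationFactor, h]
  gcongr

theorem steps_le {V : ℝ} (hV : 0 ≤ V) (hVx : V ≤ x) :
    ((⌈32 * correlationFactor P ε ^ 2 * radius P ε ^ 2 * ((4 * P ^ 5) ^ 2 + V) / ε ^ 2⌉₊ + 1 : ℕ) :
      ℝ) ≤ polyAt (stepsPoly p) x := by
  simp only [stepsPoly, polyAt_mul, polyAt_add, polyAt_pow, polyAt_ofNat, polyAt_X]
  have h1 := correlationFactor_le hP hε hPx hx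
  have h2 := radius_le hP hε hPx hx
  have h3 := correlationFactor_pos hP hε
  have h4 := radius_pos hP hε
  have h5 : 0 < 1 / ε := by positivity
  have h10 := h5.le.trans hx
  have h6 : 0 ≤ 32 * correlationFactor P ε ^ 2 * radius P ε ^ 2 * ((4 * P ^ 5) ^ 2 + V) / ε ^ 2 := by
    positivity
  have h7 : 32 * correlationFactor P ε ^ 2 * radius P ε ^ 2 * ((4 * P ^ 5) ^ 2 + V) / ε ^ 2 ≤
      32 * polyAt (correlationPoly p) x ^ 2 * polyAt (radiusPoly p) x ^ 2 *
        ((4 * polyAt p x ^ 5) ^ 2 + x) * x ^ 2 := by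
    rw [div_eq_mul_one_div, ← one_div_pow]
    gcongr
  push_cast
  -- Rounding up costs less than 1 and the step count adds 1, hence the `+ 2` in `stepsPoly`.
  linarith [Nat.ceil_lt_add_one h6]

end ParameterPolynomials

end CombOpt

/-! ### Assembly of the theorem. -/

theorem theorem1 (p : Polynomial ℕ) :
    ∃ q : Polynomial ℕ, ∀ (N : ℕ) (ε : ℝ), 0 < ε →
      ∃ (β ρ : Set.Ioo (0 : ℝ) 1) (lam B : ℝ) (η : ℝ → ℝ) (T : ℝ → ℕ),
        0 < lam ∧ 0 < B ∧
        1 / β.1 ≤ CombOpt.polyAt q (N + 1 / ε) ∧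
        1 / ρ.1 ≤ CombOpt.polyAt q (N + 1 / ε) ∧
        1 / lam ≤ CombOpt.polyAt q (N + 1 / ε) ∧
        B ≤ CombOpt.polyAt q (N + 1 / ε) ∧
        (∀ V : ℝ, 0 ≤ V →
          0 < η V ∧ 0 < T V ∧ (T V : ℝ) ≤ CombOpt.polyAt q (N + 1 / ε + V)) ∧
        ∀ (S : Type u) (I : Type v) [Fintype S] [Nonempty S] [Fintype I] (L : I → S → ℝ),
          CombOpt.HasDescriptionSize I N →
          CombOpt.HasDescriptionSize S (p.eval N) →
          ∀ F : CombOpt.FeatureMaps L, F.PolyBounded p N →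
          ∀ R : stdSimplex ℝ I,
            CombOpt.CompleteAt (Metric.closedBall (0 : F.Param) B) (F.loss R β ρ)
              (CombOpt.opt R L) ε (-(1 / lam) • F.M) ∧
            CombOpt.Compressed q N ε (Metric.closedBall (0 : F.Param) B) ∧
            CombOpt.OptimizableByDescent.{w} (Metric.closedBall (0 : F.Param) B)
              (F.loss R β ρ) (F.regLoss R β ρ lam) (-(1 / lam) • F.M) ε η T := by
  open CombOpt in
  set r : Polynomial ℕ := p + 1 with hr
  have hrx : ∀ x, polyAt r x = polyAt p x + 1 := fun x => by rw [hr, polyAt_add, polyAt_one]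
  -- With natural coefficients, a sum dominates each summand at nonnegative arguments.
  refine ⟨entropyPoly r + radiusPoly r + slowWeightPoly r + slowScalePoly r + stepsPoly r +
    r ^ 2 + bitsPoly r, fun N ε hε => ?_⟩
  set q := entropyPoly r + radiusPoly r + slowWeightPoly r + slowScalePoly r + stepsPoly r +
    r ^ 2 + bitsPoly r with hq
  have hqx : ∀ x, 0 ≤ x → polyAt (entropyPoly r) x ≤ polyAt q x ∧
      polyAt (radiusPoly r) x ≤ polyAt q x ∧ polyAt (slowWeightPoly r) x ≤ polyAt q x ∧
      polyAt (slowScalePoly r) x ≤ polyAt q x ∧ polyAt (stepsPoly r) x ≤ polyAt q x ∧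
      polyAt (r ^ 2) x ≤ polyAt q x ∧ polyAt (bitsPoly r) x ≤ polyAt q x := fun x hx => by
    have h1 := polyAt_nonneg (entropyPoly r) hx
    have h2 := polyAt_nonneg (radiusPoly r) hx
    have h3 := polyAt_nonneg (slowWeightPoly r) hx
    have h4 := polyAt_nonneg (slowScalePoly r) hx
    have h5 := polyAt_nonneg (stepsPoly r) hx
    have h6 := polyAt_nonneg (r ^ 2) hx
    have h7 := polyAt_nonneg (bitsPoly r) hx
    simp only [hq, polyAt_add]
    refine ⟨?_, ?_, ?_, ?_, ?_, ?_, ?_⟩ <;> linarith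
  have hN : (0 : ℝ) ≤ N := Nat.cast_nonneg N
  have hε' : 0 < 1 / ε := by positivity
  have hP : 1 ≤ polyAt r N := by rw [hrx]; linarith [polyAt_nonneg p hN]
  have hx0 : 0 ≤ N + 1 / ε := by positivity
  have hx1 : 1 / ε ≤ N + 1 / ε := by linarith
  have hPx : polyAt r N ≤ polyAt r (N + 1 / ε) := polyAt_mono r hN (by linarith)
  obtain ⟨hq1, hq2, hq3, hq4, -⟩ := hqx _ hx0
  have hc := correlationFactor_pos hP hε
  refine ⟨⟨slowWeight (polyAt r N) ε, slowWeight_mem_Ioo hP hε⟩,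
    ⟨slowScale (polyAt r N) ε, slowScale_mem_Ioo hP hε⟩, entropyWeight (polyAt r N) ε,
    radius (polyAt r N) ε,
    fun V => ε / (4 * correlationFactor (polyAt r N) ε * ((4 * polyAt r N ^ 5) ^ 2 + V)),
    fun V => ⌈32 * correlationFactor (polyAt r N) ε ^ 2 * radius (polyAt r N) ε ^ 2 *
      ((4 * polyAt r N ^ 5) ^ 2 + V) / ε ^ 2⌉₊ + 1, entropyWeight_pos hP hε, radius_pos hP hε,
    (one_div_slowWeight_le hP hε hPx hx1).trans hq3,
    (one_div_slowScale_le hP hε hPx hx1).trans hq4,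
    (one_div_entropyWeight_le hP hε hPx hx1).trans hq1, (radius_le hP hε hPx hx1).trans hq2,
    fun V hV => ⟨?_, ?_, ?_⟩, fun S I _ _ _ L _ hS F hF R => ?_⟩
  · positivity
  · exact Nat.succ_pos _
  · have hxV : (N : ℝ) ≤ N + 1 / ε + V := by linarith
    exact (steps_le hP hε (polyAt_mono r hN hxV) (by linarith) hV (by linarith)).trans
      (hqx _ (by positivity)).2.2.2.2.1
  -- The common bound is `r(N)`, free of `ε`; so the dimension bound involves `N` only and the bit
  -- bound only logarithms of `1 / ε` and `1 / δ`.
  · have hb : F.BoundedBy (polyAt r N) := by rw [hrx]; exact hF.boundedBy hS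
    refine ⟨hb.completeAt hε R _ _ rfl, ⟨?_, fun δ hδ => ?_⟩,
      hb.optimizableByDescent hε R _ _ rfl rfl⟩
    · refine hb.finrank_le.trans ?_
      rw [← polyAt_pow]
      exact (hqx _ hN).2.2.2.2.2.1
    · obtain ⟨b, hb1, hb2⟩ := hb.exists_describedUpTo hε hδ
      refine ⟨b, hb1, hb2.trans (le_trans ?_ (hqx _ ?_).2.2.2.2.2.2)⟩
      all_goals
        have h1 : 0 ≤ Real.log (1 + 1 / ε) := Real.log_nonneg (by simp [hε.le])
        have h2 : 0 ≤ Real.log (1 + 1 / δ) := Real.log_nonneg (by simp [hδ.le])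
      · have h3 := polyAt_mono r hN
          (by linarith : (N : ℝ) ≤ N + Real.log (1 + 1 / ε) + Real.log (1 + 1 / δ))
        simp only [bitsPoly, polyAt_mul, polyAt_add, polyAt_pow, polyAt_ofNat, polyAt_X,
          polyAt_one]
        have h4 : 4 * polyAt r N ^ 2 * (polyAt r N ^ 2 + 1) + 1 + Real.log (1 + 1 / ε) +
            Real.log (1 + 1 / δ) ≤ 4 * polyAt r N ^ 2 * (polyAt r N ^ 2 + 1) + 1 +
            (N + Real.log (1 + 1 / ε) + Real.log (1 + 1 / δ)) := by linarith
        refine le_trans (mul_le_mul_of_nonneg_left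
          (add_le_add_left (mul_le_mul_of_nonneg_left h4 zero_le_two) 1) (sq_nonneg _)) ?_
        gcongr
      · positivity
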